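/- **Setting.** Let $d,K\ge 1$ and $\mu,\zeta,L>0$, $C,\sigma\in\mathbb R$, $\beta_1\in(0,1)$. Let $\xi$ be a random variable with values in a measurable space, let $f(\theta;\xi)$ be jointly measurable in $\theta\in\mathbb R^d$ and $\xi$, and let $F(\theta)=\mathbb E_\xi[f(\theta;\xi)]$. Assume that $F$ is differentiable and that for all $\theta,\theta'\in\mathbb R^d$, all values of $\xi$ and all $i\in\{1,\dots,d\}$, $$|f(\theta;\xi)|\le C,\qquad |\nabla_iF(\theta)-\nabla_iF(\theta')|\le L\|\theta-\theta'\|,\qquad \mathbb E_\xi\big[|f(\theta;\xi)-F(\theta)|^2\big]\le\sigma^2 .$$ **Algorithm (R-AdaZO).** Start from a deterministic $\theta_0\in\mathbb R^d$, $m_0=0$, and $v_0$ with $v_{0,i}>0$ for all $i$. For $t\ge1$, draw $\xi_t$ (distributed as $\xi$) and $u_{t,1},\dots,u_{t,K}$ uniform on the unit sphere of $\mathbb R^d$, all mutually independent within and across iterations, and set (coordinatewise) $$g_t=\frac dK\sum_{k=1}^K\frac{f(\theta_{t-1}+\mu u_{t,k};\xi_t)-f(\theta_{t-1};\xi_t)}{\mu}\,u_{t,k},\qquad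 m_t=\beta_1m_{t-1}+(1-\beta_1)g_t,$$ $$v_t=\beta_2v_{t-1}+(1-\beta_2)m_t^2,\qquad \theta_t=\theta_{t-1}-\eta\,\frac{m_t}{\sqrt{v_t+\zeta}} .$$ Put $$\Sigma^2=\frac{8(\sigma^2+C^2)d}{K\mu^2},\qquad V^2=\|v_0\|+(1-\beta_1)\Sigma^2+\frac{\beta_1(1+\beta_1)^2L^2\eta^2d}{(1-\beta_1)^2(1-\beta_2)},\quad V\ge0,$$ $$c_1=\frac13\Big(\frac{8C^2d^3}{(1-\beta_1)^2\mu^2\sqrt\zeta}+\frac{2\beta_1^2d\sqrt\zeta}{(1-\beta_1)^2}\Big)^{-1},\qquad c_2=\frac13\Big(\frac{16Ld\sqrt d}{(1-\beta_1)^2}\Big)^{-1}.$$ **Theorem.** For all $a_1,a_2>0$ there is a constant $c_3>0$, depending only on $d,C,L,\mu,\zeta,\beta_1,v_0,a_1,a_2$ (and not on $K$, $\sigma$, $f$, the law of $\xi$, $\theta_0$, $\varepsilon$, $\beta_2$, $\eta$ or $T$), such that the following holds. Let $\varepsilon>0$, and let $\beta_2,\eta$ and $T\in\mathbb N$ satisfy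 $\beta_1\le\sqrt{\beta_2}$, $\beta_2\ge\frac12$ and $$a_1\varepsilon^2\le1-\beta_2\le c_1\varepsilon^2,\qquad a_2\varepsilon^2\le\eta\le c_2\varepsilon^2,\qquad T\ge c_3\,\varepsilon^{-4}.$$ Then $\|\nabla F(\theta_t)\|$ is integrable for every $t\geq 0$, and $$\frac1T\sum_{t=0}^{T-1}\mathbb E\big[\|\nabla F(\theta_t)\|\big]\le\frac{(1+\beta_1)\sqrt d}{\sqrt{\beta_1(1-\beta_2)}}\,\varepsilon^2+\Big(\sqrt[4]{\zeta}+\sqrt{Vd}\Big)\varepsilon+\mu L\sqrt d .$$ -/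

import Mathlib

open MeasureTheory ProbabilityTheory

namespace RAdaZO

/-- Euclidean space `ℝ^d`. -/
abbrev Vec (d : ℕ) : Type := EuclideanSpace ℝ (Fin d)

/-- The uniform distribution on the unit sphere of `ℝ^d` (`d ≥ 1`), seen as a measure on `ℝ^d`:
the normalized surface measure. -/
noncomputable def unifSphere (d : ℕ) : Measure (Vec d) :=
  Measure.map (fun x : Metric.sphere (0 : Vec d) 1 => (x : Vec d))
    (((volume : Measure (Vec d)).toSphere Set.univ)⁻¹ • (volume : Measure (Vec d)).toSphere)

/-- The objective `F(θ) = E_ξ[f(θ; ξ)]`, where `ξ` has law `P`. -/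
noncomputable def objective {d : ℕ} {Ξ : Type*} [MeasurableSpace Ξ] (P : Measure Ξ)
    (f : Vec d → Ξ → ℝ) (θ : Vec d) : ℝ :=
  ∫ z, f θ z ∂P

/-- The function values are bounded by `C`, and the partial derivatives of `F` exist and are
`L`-Lipschitz. (A function with Lipschitz partial derivatives is differentiable.) -/
structure BoundedSmooth {d : ℕ} {Ξ : Type*} [MeasurableSpace Ξ] (P : Measure Ξ)
    (f : Vec d → Ξ → ℝ) (C L : ℝ) : Prop where
  bounded : ∀ θ z, |f θ z| ≤ C
  differentiable : Differentiable ℝ (objective P f)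
  smooth : ∀ (θ θ' : Vec d) (i : Fin d),
    |gradient (objective P f) θ i - gradient (objective P f) θ' i| ≤ L * ‖θ - θ'‖

/-- The variance of the function values is at most `σ²`. -/
def BoundedVariance {d : ℕ} {Ξ : Type*} [MeasurableSpace Ξ] (P : Measure Ξ)
    (f : Vec d → Ξ → ℝ) (σ : ℝ) : Prop :=
  ∀ θ, ∫ z, |f θ z - objective P f θ| ^ 2 ∂P ≤ σ ^ 2

/-- The zeroth-order gradient estimator
`(d / K) ∑ₖ ((f(θ + μ uₖ; z) - f(θ; z)) / μ) uₖ`. -/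
noncomputable def zoGrad {d K : ℕ} {Ξ : Type*} (f : Vec d → Ξ → ℝ) (μ : ℝ)
    (θ : Vec d) (z : Ξ) (u : Fin K → Vec d) : Vec d :=
  ((d : ℝ) / (K : ℝ)) • ∑ k, ((f (θ + μ • u k) z - f θ z) / μ) • u k

/-- The iterate, the first moment estimate and the second moment estimate. -/
structure State (d : ℕ) where
  θ : Vec d
  m : Vec d
  v : Vec d

/-- `m ← β₁ m + (1 - β₁) g`. -/
noncomputable def nextM {d : ℕ} (β₁ : ℝ) (s : State d) (g : Vec d) : Vec d :=
  β₁ • s.m + (1 - β₁) • g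

/-- `v ← β₂ v + (1 - β₂) m²` (coordinatewise), with the already updated `m`. -/
noncomputable def nextV {d : ℕ} (β₁ β₂ : ℝ) (s : State d) (g : Vec d) : Vec d :=
  WithLp.toLp 2 fun i => β₂ * s.v i + (1 - β₂) * (nextM β₁ s g i) ^ 2

/-- `θ ← θ - η m / √(v + ζ)` (coordinatewise), with the already updated `m` and `v`. -/
noncomputable def nextθ {d : ℕ} (β₁ β₂ ζ η : ℝ) (s : State d) (g : Vec d) : Vec d :=
  WithLp.toLp 2 fun i => s.θ i - η * (nextM β₁ s g i / √(nextV β₁ β₂ s g i + ζ))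

/-- The run of R-AdaZO on given samples, from `θ₀`, `m₀ = 0`, `v₀`. Iteration `t + 1` goes from
state `t` to state `t + 1` and uses the data sample `z t` and the `K` directions `u t`. -/
noncomputable def run {d K : ℕ} {Ξ : Type*} (f : Vec d → Ξ → ℝ) (μ β₁ β₂ ζ η : ℝ)
    (θ₀ v₀ : Vec d) (z : ℕ → Ξ) (u : ℕ → Fin K → Vec d) : ℕ → State d
  | 0 => ⟨θ₀, 0, v₀⟩
  | t + 1 =>
    let s := run f μ β₁ β₂ ζ η θ₀ v₀ z u t
    let g := zoGrad f μ s.θ (z t) (u t)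
    ⟨nextθ β₁ β₂ ζ η s g, nextM β₁ s g, nextV β₁ β₂ s g⟩

/-- The random variables `ξ t` (law `P`) and `u t k` (uniform on the unit sphere), for `t : ℕ` and
`k : Fin K`, are all mutually independent: within one iteration the joint law is the product law,
and different iterations are independent. -/
structure IsSampling {d K : ℕ} {Ξ Ω : Type*} [MeasurableSpace Ξ] [MeasurableSpace Ω]
    (P : Measure Ξ) (Q : Measure Ω) (ξ : ℕ → Ω → Ξ) (u : ℕ → Fin K → Ω → Vec d) : Prop where
  measurable_ξ : ∀ t, Measurable (ξ t)
  measurable_u : ∀ t k, Measurable (u t k)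
  law : ∀ t, Measure.map (fun ω => (ξ t ω, fun k => u t k ω)) Q
    = P.prod (Measure.pi fun _ : Fin K => unifSphere d)
  indep : iIndepFun (fun t ω => (ξ t ω, fun k => u t k ω)) Q

/-- The `t`-th iterate `θ_t` of R-AdaZO, as a random variable. -/
noncomputable def iterate {d K : ℕ} {Ξ Ω : Type*} (f : Vec d → Ξ → ℝ) (μ β₁ β₂ ζ η : ℝ)
    (θ₀ v₀ : Vec d) (ξ : ℕ → Ω → Ξ) (u : ℕ → Fin K → Ω → Vec d) (t : ℕ) (ω : Ω) : Vec d :=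
  (run f μ β₁ β₂ ζ η θ₀ v₀ (fun s => ξ s ω) (fun s k => u s k ω) t).θ

/-- `Σ² = 8 (σ² + C²) d / (K μ²)`. -/
noncomputable def sigmaSq (d K : ℕ) (C σ μ : ℝ) : ℝ :=
  8 * (σ ^ 2 + C ^ 2) * d / (K * μ ^ 2)

/-- `V`, where
`V² = ‖v₀‖ + (1 - β₁) Σ² + β₁ (1 + β₁)² L² η² d / ((1 - β₁)² (1 - β₂))`. -/
noncomputable def V {d : ℕ} (K : ℕ) (C L σ μ β₁ β₂ η : ℝ) (v₀ : Vec d) : ℝ :=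
  √(‖v₀‖ + (1 - β₁) * sigmaSq d K C σ μ
    + β₁ * (1 + β₁) ^ 2 * L ^ 2 * η ^ 2 * d / ((1 - β₁) ^ 2 * (1 - β₂)))

/-- The constant in `1 - β₂ ≤ c₁ ε²`. -/
noncomputable def c₁ (d : ℕ) (C μ ζ β₁ : ℝ) : ℝ :=
  (8 * C ^ 2 * d ^ 3 / ((1 - β₁) ^ 2 * μ ^ 2 * √ζ)
    + 2 * β₁ ^ 2 * d * √ζ / (1 - β₁) ^ 2)⁻¹ / 3

/-- The constant in `η ≤ c₂ ε²`. As `β₂ < 1`, it is at least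
`(16 L d √d / ((1 - β₁ / √β₂) (1 - β₁)))⁻¹ / 3`. -/
noncomputable def c₂ (d : ℕ) (L β₁ : ℝ) : ℝ :=
  (16 * L * d * √d / ((1 - β₁) * (1 - β₁)))⁻¹ / 3

end RAdaZO

/-!
The argument is a Lyapunov analysis of the ball average `F_μ` of the objective `F` (`smoothed`).

The gradient estimator is an unbiased estimator of `∇F_μ` (`integral_zoGrad`). This is the
divergence theorem on the ball, `integral_ball_fderiv_eq_integral_sphere`, which is obtained from
integration by parts against radial cutoffs and polar coordinates. As `∇F` is `L √d`-Lipschitz, so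
is `∇F_μ`, and the two differ by at most `μ L √d`, the last term of the bound. As `|f| ≤ C`, all
gradient estimates, momenta and `∇F_μ` have norm at most `B = 2 C d / μ`, and `vₜ ≤ v₀ + B²`.

Along a run, `inner_precond_le_energy_sub` bounds the pairing of `∇F_μ(θₜ) / √(β₂ vₜ + ζ)` with the
next gradient estimate by the increment of an energy plus `O(η + (1 - β₂))`. Three effects are
controlled there. Using `β₂ vₜ` instead of `vₜ₊₁` in the denominator, which makes the direction
independent of the next sample, costs `(1 - β₂) B² / √ζ` times the squared normalized step; the
momentum telescopes into the inner product of `∇F_μ(θₜ)` with the normalized momentum; and the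
squared normalized steps, whose pointwise bounds degenerate for small `ζ`, are absorbed by the
increments of `∑ᵢ log (vᵢ + ζ)` together with a drift `2 d (1 - β₂)`.

In expectation, independence of the samples (`IsSampling.integral_inner_zoGrad`) turns the pairing
into `∑ᵢ ∂ᵢF_μ(θₜ)² / √(β₂ vₜᵢ + ζ)`. The constants `c₁`, `c₂` and the choice of `c₃` bound the
time average of its mean by `ε²` (`energy_budget_le`). The denominators are at most
`W = √(‖v₀‖ + B² + ζ)`, hence the mean of `‖∇F_μ(θₜ)‖` is on average at most `√W ε`
(`average_norm_gradient_le`). Finally `√W ≤ ‖v₀‖^(1/4) + √B + ζ^(1/4)`. Here `‖v₀‖^(1/4)` is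
dominated by `√(V d)`, and `√B ε` by the first term of the bound
(`sqrt_mul_le_of_le_c₁_mul`): the inequality between arithmetic and geometric mean, applied to the
two summands of `c₁⁻¹`, shows `β₁ (1 - β₂) B ≤ ε²`.
-/

/-! ### The divergence theorem on the unit ball -/

section Divergence

open Set Metric in
theorem continuous_integral_sphere {E : Type*} [NormedAddCommGroup E] [InnerProductSpace ℝ E]
    [FiniteDimensional ℝ E] [MeasurableSpace E] [BorelSpace E] (μ : Measure E) [μ.IsAddHaarMeasure]
    {h : ℝ → E → ℝ} (hh : Continuous (Function.uncurry h)) :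
    Continuous fun r : ℝ => ∫ u : sphere (0 : E) 1, h r u ∂μ.toSphere := by
  have := continuous_parametric_integral_of_continuous (μ := μ.toSphere)
    (f := fun (r : ℝ) (u : sphere (0 : E) 1) => h r u)
    (by exact hh.comp (continuous_fst.prodMk (continuous_subtype_val.comp continuous_snd)))
    (s := univ) isCompact_univ
  simpa using this

variable {E : Type*} [NormedAddCommGroup E] [InnerProductSpace ℝ E] [Nontrivial E]
  [FiniteDimensional ℝ E] [MeasurableSpace E] [BorelSpace E]

open Set Metric Module in
/-- Integration in polar coordinates. -/
theorem integral_eq_integral_Ioi_integral_sphere (μ : Measure E) [μ.IsAddHaarMeasure]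
    {h : E → ℝ} (hh : Integrable h μ) :
    ∫ x, h x ∂μ = ∫ r in Ioi (0 : ℝ),
      r ^ (finrank ℝ E - 1) * ∫ u : sphere (0 : E) 1, h (r • (u : E)) ∂μ.toSphere := by
  have hmp := μ.measurePreserving_homeomorphUnitSphereProd
  have hemb := (homeomorphUnitSphereProd E).measurableEmbedding
  set g : sphere (0 : E) 1 × Ioi (0 : ℝ) → ℝ := fun p => h ((p.2 : ℝ) • (p.1 : E)) with hg
  have hgc : ∀ x : ({0}ᶜ : Set E), g (homeomorphUnitSphereProd E x) = h x := fun x => by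
    have hx : ‖(x : E)‖ ≠ 0 := norm_ne_zero_iff.2 x.2
    simp [hg, smul_smul, hx]
  have hint : Integrable g (μ.toSphere.prod (.volumeIoiPow (finrank ℝ E - 1))) := by
    rw [← hmp.integrable_comp_emb hemb, Function.comp_def]
    simp only [hgc]
    have : IntegrableOn h ({0}ᶜ : Set E) μ := hh.integrableOn
    rwa [integrableOn_iff_comap_subtypeVal (measurableSet_singleton _).compl] at this
  calc
    ∫ x, h x ∂μ = ∫ x : ({0}ᶜ : Set E), h x ∂(μ.comap (↑)) := by
      rw [integral_subtype_comap (measurableSet_singleton _).compl h, restrict_compl_singleton]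
    _ = ∫ p, g p ∂μ.toSphere.prod (.volumeIoiPow (finrank ℝ E - 1)) := by
      rw [← hmp.integral_comp hemb]
      simp only [hgc]
    _ = ∫ r : Ioi (0 : ℝ), ∫ u, g (u, r) ∂μ.toSphere ∂.volumeIoiPow (finrank ℝ E - 1) :=
      integral_prod_symm g hint
    _ = _ := by
      simp only [Measure.volumeIoiPow, ENNReal.ofReal, hg]
      rw [integral_withDensity_eq_integral_smul,
        integral_subtype_comap measurableSet_Ioi fun r : ℝ =>
          Real.toNNReal (r ^ (finrank ℝ E - 1)) •
            ∫ u : sphere (0 : E) 1, h (r • (u : E)) ∂μ.toSphere,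
        setIntegral_congr_fun measurableSet_Ioi fun x hx => ?_]
      · simp only [NNReal.smul_def, Real.coe_toNNReal _ (pow_nonneg (le_of_lt hx) _), smul_eq_mul]
      · exact (measurable_subtype_coe.pow_const _).real_toNNReal

open Set Metric Module in
theorem integral_ball_eq_intervalIntegral_sphere (μ : Measure E) [μ.IsAddHaarMeasure]
    {h : E → ℝ} (hh : Continuous h) :
    ∫ x in ball (0 : E) 1, h x ∂μ = ∫ r in (0 : ℝ)..1,
      r ^ (finrank ℝ E - 1) * ∫ u : sphere (0 : E) 1, h (r • (u : E)) ∂μ.toSphere := by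
  have hint : IntegrableOn h (ball (0 : E) 1) μ :=
    (hh.continuousOn.integrableOn_compact (isCompact_closedBall 0 1)).mono_set ball_subset_closedBall
  rw [← integral_indicator measurableSet_ball,
    integral_eq_integral_Ioi_integral_sphere μ ((integrable_indicator_iff measurableSet_ball).2 hint),
    intervalIntegral.integral_of_le zero_le_one, integral_Ioc_eq_integral_Ioo,
    ← integral_indicator measurableSet_Ioi, ← integral_indicator measurableSet_Ioo]
  congr 1
  ext r
  by_cases h0 : 0 < r
  · by_cases h1 : r < 1
    · rw [indicator_of_mem (mem_Ioi.2 h0), indicator_of_mem (mem_Ioo.2 ⟨h0, h1⟩)]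
      congr 2
      ext u
      rw [indicator_of_mem]
      simpa [norm_smul, abs_of_pos h0] using h1
    · rw [indicator_of_mem (mem_Ioi.2 h0), indicator_of_notMem (fun h => h1 h.2)]
      have : ∀ u : sphere (0 : E) 1, (ball (0 : E) 1).indicator h (r • (u : E)) = 0 := fun u => by
        rw [indicator_of_notMem]
        simpa [norm_smul, abs_of_pos h0] using h1
      simp [this]
  · rw [indicator_of_notMem (by simpa using h0), indicator_of_notMem (fun h => h0 h.1)]

open Set Metric Module in
/-- The divergence theorem on the unit ball for a vector field of constant direction `v`.
Integration by parts against radial cutoffs `φ(‖x‖)` shows, in polar coordinates, that the radial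
function `r ↦ r ^ (n - 1) ∫ F(r u) ⟪u, v⟫ du` has the weak derivative
`r ↦ r ^ (n - 1) ∫ ∂ᵥF(r u) du`. -/
theorem integral_ball_fderiv_eq_integral_sphere (μ : Measure E) [μ.IsAddHaarMeasure]
    {F : E → ℝ} (hF : ContDiff ℝ 1 F) (v : E) :
    ∫ x in ball (0 : E) 1, fderiv ℝ F x v ∂μ
      = ∫ u : sphere (0 : E) 1, F u * inner ℝ (u : E) v ∂μ.toSphere := by
  have hF0 : Continuous F := hF.continuous
  have hF1 : Continuous fun x => fderiv ℝ F x v :=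
    (hF.continuous_fderiv one_ne_zero).clm_apply continuous_const
  set n := finrank ℝ E - 1 with hn
  set a : ℝ → ℝ := fun r => r ^ n * ∫ u : sphere (0 : E) 1, F (r • (u : E)) * inner ℝ (u : E) v
    ∂μ.toSphere with ha
  set b : ℝ → ℝ := fun r => r ^ n * ∫ u : sphere (0 : E) 1, fderiv ℝ F (r • (u : E)) v
    ∂μ.toSphere with hb
  have hac : Continuous a := (continuous_id.pow n).mul
    (continuous_integral_sphere μ (h := fun r u => F (r • u) * inner ℝ u v)
      (by unfold Function.uncurry; fun_prop))
  have hbc : Continuous b := (continuous_id.pow n).mul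
    (continuous_integral_sphere μ (h := fun r u => fderiv ℝ F (r • u) v)
      (by unfold Function.uncurry; exact hF1.comp (by fun_prop)))
  set p : ℝ → ℝ := fun r => ∫ s in (0 : ℝ)..r, b s with hp
  have hpd : ∀ r, HasDerivAt p (b r) r := fun r =>
    intervalIntegral.integral_hasDerivAt_right (hbc.intervalIntegrable _ _)
      (hbc.stronglyMeasurableAtFilter _ _) hbc.continuousAt
  have hpc : Continuous p := continuous_iff_continuousAt.2 fun r => (hpd r).continuousAt
  -- The weak form of `a' = b`, tested against the antiderivative of `ψ` that vanishes at infinity.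
  have key : ∀ ψ : ℝ → ℝ, ContDiff ℝ (⊤ : ℕ∞) ψ → HasCompactSupport ψ → tsupport ψ ⊆ Ioi 0 →
      ∫ r, ψ r • (a r - p r) = 0 := by
    intro ψ hψ hψc hψs
    have hψ0 : Continuous ψ := hψ.continuous
    obtain ⟨M, hM⟩ : ∃ M, ∀ r, M ≤ r → ψ r = 0 := by
      obtain ⟨M, hM⟩ := hψc.isCompact.bddAbove
      refine ⟨M + 1, fun r hr => image_eq_zero_of_notMem_tsupport fun h => ?_⟩
      linarith [hM h]
    obtain ⟨M, hM0, hM⟩ : ∃ M, 0 < M ∧ ∀ r, M ≤ r → ψ r = 0 :=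
      ⟨max M 1, by positivity, fun r hr => hM r ((le_max_left _ _).trans hr)⟩
    have hψneg : ∀ r, r ≤ 0 → ψ r = 0 := fun r hr =>
      image_eq_zero_of_notMem_tsupport fun h => absurd (hψs h) (by simpa using hr)
    set φ : ℝ → ℝ := fun r => ∫ s in M..r, ψ s with hφ
    have hφd : ∀ r, HasDerivAt φ (ψ r) r := fun r =>
      intervalIntegral.integral_hasDerivAt_right (hψ0.intervalIntegrable _ _)
        (hψ0.stronglyMeasurableAtFilter _ _) hψ0.continuousAt
    have hφc : Continuous φ := continuous_iff_continuousAt.2 fun r => (hφd r).continuousAt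
    have hφM : ∀ r, M ≤ r → φ r = 0 := fun r hr => by
      rw [hφ]
      refine (intervalIntegral.integral_congr (g := fun _ => (0 : ℝ)) fun s hs => ?_).trans (by simp)
      rw [uIcc_of_le hr] at hs
      exact hM s hs.1
    have hgd : ∀ x : E, HasFDerivAt (fun x : E => φ ‖x‖)
        ((ψ ‖x‖ / ‖x‖) • innerSL ℝ x) x := by
      intro x
      by_cases hx : x = 0
      · -- Near the origin `ψ` vanishes, so the cutoff is constant and the norm does no harm.
        subst hx
        have h1 : ∀ᶠ r in nhds (0 : ℝ), ψ r = 0 := by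
          have : (tsupport ψ)ᶜ ∈ nhds (0 : ℝ) :=
            (isClosed_tsupport ψ).isOpen_compl.mem_nhds fun h => lt_irrefl (0 : ℝ) (hψs h)
          filter_upwards [this] with r hr using image_eq_zero_of_notMem_tsupport hr
        obtain ⟨δ, hδ, h1⟩ := Metric.eventually_nhds_iff_ball.1 h1
        have h2 : (fun x : E => φ ‖x‖) =ᶠ[nhds 0] fun _ => φ 0 := by
          filter_upwards [Metric.ball_mem_nhds (0 : E) hδ] with y hy
          rw [mem_ball_zero_iff] at hy
          have : φ ‖y‖ - φ 0 = ∫ s in (0 : ℝ)..‖y‖, ψ s := by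
            rw [hφ]
            exact intervalIntegral.integral_interval_sub_left (hψ0.intervalIntegrable _ _)
              (hψ0.intervalIntegrable _ _)
          rw [← sub_eq_zero, this]
          refine (intervalIntegral.integral_congr (g := fun _ => (0 : ℝ)) fun s hs => ?_).trans
            (by simp)
          rw [uIcc_of_le (norm_nonneg y)] at hs
          exact h1 s (by rw [mem_ball_zero_iff, Real.norm_of_nonneg hs.1]; linarith [hs.2])
        simpa using (hasFDerivAt_const (φ 0) (0 : E)).congr_of_eventuallyEq h2
      · have h1 : HasFDerivAt (fun x : E => ‖x‖) (‖x‖⁻¹ • innerSL ℝ x) x := by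
          have h2 := ((hasStrictFDerivAt_norm_sq x).hasFDerivAt).sqrt
            (by simpa using hx)
          simp only [Real.sqrt_sq (norm_nonneg _)] at h2
          convert h2 using 1
          ext y
          simp
          field_simp
        have := (hφd ‖x‖).comp_hasFDerivAt x h1
        simpa [smul_smul, div_eq_mul_inv, Function.comp_def] using this
    have hgs : HasCompactSupport fun x : E => φ ‖x‖ :=
      HasCompactSupport.intro (isCompact_closedBall (0 : E) M) fun x hx => hφM _ (by
        rw [mem_closedBall_zero_iff] at hx; linarith)
    have hgs' : HasCompactSupport fun x : E => ψ ‖x‖ / ‖x‖ * inner ℝ x v :=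
      HasCompactSupport.intro (isCompact_closedBall (0 : E) M) fun x hx => by
        rw [hM ‖x‖ (by rw [mem_closedBall_zero_iff] at hx; linarith)]; simp
    have hgc : Continuous fun x : E => φ ‖x‖ := hφc.comp continuous_norm
    have hgc' : Continuous fun x : E => ψ ‖x‖ / ‖x‖ * inner ℝ x v := by
      refine Continuous.mul ?_ (by fun_prop)
      have h1 : Continuous fun r => ψ r / r := by
        refine continuous_iff_continuousAt.2 fun r => ?_
        by_cases hr : r = 0
        · subst hr
          have : (fun r => ψ r / r) =ᶠ[nhds 0] fun _ => 0 := by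
            filter_upwards [(isClosed_tsupport ψ).isOpen_compl.mem_nhds
              fun h => lt_irrefl (0 : ℝ) (hψs h)] with r hr
            rw [image_eq_zero_of_notMem_tsupport hr, zero_div]
          exact continuousAt_const.congr this.symm
        · exact hψ0.continuousAt.div continuousAt_id hr
      exact h1.comp continuous_norm
    have hfd : ∀ x : E, fderiv ℝ (fun x : E => φ ‖x‖) x v = ψ ‖x‖ / ‖x‖ * inner ℝ x v := fun x => by
      rw [(hgd x).fderiv]; simp
    have i1 : Integrable (fun x => fderiv ℝ F x v * φ ‖x‖) μ :=
      (hF1.mul hgc).integrable_of_hasCompactSupport hgs.mul_left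
    have i2 : Integrable (fun x => F x * (ψ ‖x‖ / ‖x‖ * inner ℝ x v)) μ :=
      (hF0.mul hgc').integrable_of_hasCompactSupport hgs'.mul_left
    have i3 : Integrable (fun x => F x * φ ‖x‖) μ :=
      (hF0.mul hgc).integrable_of_hasCompactSupport hgs.mul_left
    have parts : ∫ x, F x * (ψ ‖x‖ / ‖x‖ * inner ℝ x v) ∂μ = -∫ x, fderiv ℝ F x v * φ ‖x‖ ∂μ := by
      have := integral_mul_fderiv_eq_neg_fderiv_mul_of_integrable (μ := μ) (f := F)
        (g := fun x : E => φ ‖x‖) (v := v) i1 (by simpa only [hfd] using i2) i3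
        (fun x _ => hF.differentiable one_ne_zero x) (fun x _ => (hgd x).differentiableAt)
      simpa only [hfd] using this
    have hl : ∫ x, F x * (ψ ‖x‖ / ‖x‖ * inner ℝ x v) ∂μ = ∫ r in Ioi (0 : ℝ), ψ r * a r := by
      rw [integral_eq_integral_Ioi_integral_sphere μ i2]
      refine setIntegral_congr_fun measurableSet_Ioi fun r hr => ?_
      have hr : 0 < r := hr
      simp only [ha]
      rw [mul_left_comm (ψ r), ← integral_const_mul (ψ r)]
      congr 1
      refine integral_congr_ae (.of_forall fun u => ?_)
      simp only [norm_smul, Real.norm_eq_abs, abs_of_pos hr, norm_eq_of_mem_sphere, mul_one,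
        inner_smul_left, conj_trivial]
      field_simp
    have hr : ∫ x, fderiv ℝ F x v * φ ‖x‖ ∂μ = ∫ r in Ioi (0 : ℝ), φ r * b r := by
      rw [integral_eq_integral_Ioi_integral_sphere μ i1]
      refine setIntegral_congr_fun measurableSet_Ioi fun r hr => ?_
      have hr : 0 < r := hr
      simp only [hb]
      rw [mul_left_comm (φ r), ← integral_const_mul (φ r)]
      congr 1
      refine integral_congr_ae (.of_forall fun u => ?_)
      simp only [norm_smul, Real.norm_eq_abs, abs_of_pos hr, norm_eq_of_mem_sphere, mul_one]
      ring
    have restr : ∀ q : ℝ → ℝ, (∀ r, M ≤ r → q r = 0) →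
        ∫ r in Ioi (0 : ℝ), q r = ∫ r in (0 : ℝ)..M, q r := by
      intro q hq
      rw [intervalIntegral.integral_of_le hM0.le]
      refine setIntegral_eq_of_subset_of_forall_sdiff_eq_zero measurableSet_Ioi
        Ioc_subset_Ioi_self fun r hr => hq r ?_
      by_contra h
      exact hr.2 ⟨hr.1, (not_le.1 h).le⟩
    have byparts : ∫ r in (0 : ℝ)..M, φ r * b r = -∫ r in (0 : ℝ)..M, ψ r * p r := by
      rw [intervalIntegral.integral_mul_deriv_eq_deriv_mul (fun r _ => hφd r) (fun r _ => hpd r)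
        (hψ0.intervalIntegrable _ _) (hbc.intervalIntegrable _ _), hφM M le_rfl]
      simp [hp]
    have hfull : ∫ r, ψ r • (a r - p r) = ∫ r in Ioi (0 : ℝ), ψ r • (a r - p r) := by
      refine (setIntegral_eq_integral_of_forall_compl_eq_zero fun r hr => ?_).symm
      rw [hψneg r (by simpa using hr), zero_smul]
    rw [hfull, restr _ fun r hr => by rw [hM r hr, zero_smul]]
    simp only [smul_eq_mul, mul_sub]
    rw [intervalIntegral.integral_sub (Continuous.intervalIntegrable (by fun_prop) _ _)
      (Continuous.intervalIntegrable (by fun_prop) _ _), ← restr (fun r => ψ r * a r) fun r hr => by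
        rw [hM r hr, zero_mul], ← hl, parts, hr,
      restr _ fun r hr => by rw [hφM r hr, zero_mul], byparts]
    ring
  have hae := isOpen_Ioi.ae_eq_zero_of_integral_contDiff_smul_eq_zero (U := Ioi (0 : ℝ))
    (f := fun r => a r - p r) (μ := volume)
    ((hac.sub hpc).locallyIntegrable.locallyIntegrableOn _)
    (fun ψ h1 h2 h3 => key ψ h1 h2 h3)
  have heq : EqOn (fun r => a r - p r) (fun _ => 0) (Ioi 0) :=
    Measure.eqOn_open_of_ae_eq (μ := volume) ((ae_restrict_iff' measurableSet_Ioi).2 hae)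
      isOpen_Ioi (hac.sub hpc).continuousOn continuousOn_const
  have h1 : a 1 - p 1 = 0 := heq (mem_Ioi.2 one_pos)
  rw [integral_ball_eq_intervalIntegral_sphere μ hF1]
  have : a 1 = ∫ u : sphere (0 : E) 1, F u * inner ℝ (u : E) v ∂μ.toSphere := by simp [ha]
  rw [← this]
  exact (sub_eq_zero.1 h1).symm

end Divergence

namespace RAdaZO

/-! ### Uniform measures on the sphere and on the ball -/

/-- The uniform distribution on the unit ball of `ℝ^d`. -/
noncomputable def unifBall (d : ℕ) : Measure (Vec d) :=
  (volume (Metric.ball (0 : Vec d) 1))⁻¹ • volume.restrict (Metric.ball (0 : Vec d) 1)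

instance isProbabilityMeasure_unifBall (d : ℕ) : IsProbabilityMeasure (unifBall d) := by
  constructor
  have h0 : volume (Metric.ball (0 : Vec d) 1) ≠ 0 := (Metric.measure_ball_pos _ _ one_pos).ne'
  simpa [unifBall] using ENNReal.inv_mul_cancel h0 measure_ball_lt_top.ne

theorem ae_norm_le_one_unifBall (d : ℕ) : ∀ᵐ b ∂unifBall d, ‖b‖ ≤ 1 := by
  refine Measure.ae_smul_measure ?_ _
  filter_upwards [ae_restrict_mem Metric.isOpen_ball.measurableSet] with b hb
  exact (mem_ball_zero_iff.1 hb).le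

theorem isProbabilityMeasure_unifSphere {d : ℕ} (hd : 0 < d) :
    IsProbabilityMeasure (unifSphere d) := by
  have : Nonempty (Fin d) := ⟨⟨0, hd⟩⟩
  have : Nontrivial (Vec d) := inferInstance
  have hm : Measurable fun x : Metric.sphere (0 : Vec d) 1 => (x : Vec d) := measurable_subtype_coe
  constructor
  rw [unifSphere, Measure.map_apply hm .univ, Set.preimage_univ, Measure.smul_apply, smul_eq_mul]
  exact ENNReal.inv_mul_cancel (by
    simpa only [ne_eq, Measure.measure_univ_eq_zero] using
      Measure.toSphere_ne_zero (volume : Measure (Vec d))) (measure_ne_top _ _)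

theorem ae_norm_eq_one_unifSphere (d : ℕ) : ∀ᵐ u ∂unifSphere d, ‖u‖ = 1 := by
  rw [unifSphere, ae_map_iff (by fun_prop) (measurableSet_eq_fun measurable_norm measurable_const)]
  exact .of_forall fun u => norm_eq_of_mem_sphere u

theorem integral_unifSphere {d : ℕ} {h : Vec d → ℝ} (hh : Continuous h) :
    ∫ u, h u ∂unifSphere d = ((volume : Measure (Vec d)).toSphere.real Set.univ)⁻¹ *
      ∫ u : Metric.sphere (0 : Vec d) 1, h u ∂(volume : Measure (Vec d)).toSphere := by
  rw [unifSphere, integral_map (by fun_prop) hh.aestronglyMeasurable, integral_smul_measure,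
    smul_eq_mul, Measure.real, ENNReal.toReal_inv]

theorem integrable_unifBall {d : ℕ} {G : Type*} [NormedAddCommGroup G] {h : Vec d → G}
    (hh : Continuous h) : Integrable h (unifBall d) := by
  refine Integrable.smul_measure ?_ (ENNReal.inv_ne_top.2 (Metric.measure_ball_pos _ _ one_pos).ne')
  exact (hh.continuousOn.integrableOn_compact (isCompact_closedBall 0 1)).mono_set
    Metric.ball_subset_closedBall

/-- The divergence theorem, normalized: `|S^{d-1}| = d |B^d|`. -/
theorem integral_unifBall_fderiv {d : ℕ} (hd : 0 < d) {F : Vec d → ℝ} (hF : ContDiff ℝ 1 F)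
    (v : Vec d) :
    ∫ b, fderiv ℝ F b v ∂unifBall d = d * ∫ u, F u * inner ℝ u v ∂unifSphere d := by
  have : Nonempty (Fin d) := ⟨⟨0, hd⟩⟩
  have : Nontrivial (Vec d) := inferInstance
  have hB : (volume : Measure (Vec d)).real (Metric.ball 0 1) ≠ 0 :=
    (ENNReal.toReal_pos (Metric.measure_ball_pos _ _ one_pos).ne' measure_ball_lt_top.ne).ne'
  have hd' : (d : ℝ) ≠ 0 := by positivity
  rw [integral_unifSphere (by have := hF.continuous; fun_prop), unifBall, integral_smul_measure,
    integral_ball_fderiv_eq_integral_sphere _ hF, Measure.toSphere_real_apply_univ,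
    finrank_euclideanSpace_fin, ENNReal.toReal_inv, smul_eq_mul, ← Measure.real]
  field_simp

/-! ### Smoothing over a ball -/

/-- `F_μ(θ)`, the average of `F` over the ball of radius `μ` around `θ`. -/
noncomputable def smoothed {d : ℕ} (F : Vec d → ℝ) (μ : ℝ) (θ : Vec d) : ℝ :=
  ∫ b, F (θ + μ • b) ∂unifBall d

/-- `∇F_μ(θ)`, encoded as the average of `∇F` over the ball of radius `μ` around `θ`. -/
noncomputable def smoothedGrad {d : ℕ} (F : Vec d → ℝ) (μ : ℝ) (θ : Vec d) : Vec d :=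
  ∫ b, gradient F (θ + μ • b) ∂unifBall d

section Smoothing

variable {d : ℕ} {F : Vec d → ℝ} {Λ μ C : ℝ}

theorem continuous_of_norm_sub_le_mul {G : Vec d → Vec d}
    (hG : ∀ x y, ‖G x - G y‖ ≤ Λ * ‖x - y‖) : Continuous G := by
  refine (LipschitzWith.of_dist_le' (K := Λ) fun x y => ?_).continuous
  simpa only [dist_eq_norm] using hG x y

theorem inner_gradient_eq_fderiv (F : Vec d → ℝ) (x v : Vec d) :
    inner ℝ (gradient F x) v = fderiv ℝ F x v := by
  simp [gradient]

theorem contDiff_one_of_gradient_continuous (hF : Differentiable ℝ F)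
    (hG : Continuous (gradient F)) : ContDiff ℝ 1 F := by
  refine contDiff_one_iff_fderiv.2 ⟨hF, ?_⟩
  have : fderiv ℝ F = fun x => InnerProductSpace.toDual ℝ (Vec d) (gradient F x) := by
    ext x : 1
    simp [gradient]
  rw [this]
  exact (InnerProductSpace.toDual ℝ (Vec d)).continuous.comp hG

/-- The descent lemma. The constant `Λ`, instead of the optimal `Λ / 2`, comes directly from the mean
value inequality and suffices here. -/
theorem le_add_inner_gradient (hF : Differentiable ℝ F)
    (hG : ∀ x y, ‖gradient F x - gradient F y‖ ≤ Λ * ‖x - y‖) (hΛ : 0 ≤ Λ) (x y : Vec d) :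
    F y ≤ F x + inner ℝ (gradient F x) (y - x) + Λ * ‖y - x‖ ^ 2 := by
  have h := (convex_closedBall x ‖y - x‖).norm_image_sub_le_of_norm_fderiv_le'
    (𝕜 := ℝ) (f := F) (φ := fderiv ℝ F x) (C := Λ * ‖y - x‖) (x := x) (y := y)
    (fun z _ => hF z) (fun z hz => by
      have h1 : fderiv ℝ F z - fderiv ℝ F x =
          InnerProductSpace.toDual ℝ (Vec d) (gradient F z - gradient F x) := by
        simp [gradient]
      rw [h1, LinearIsometryEquiv.norm_map]
      refine (hG z x).trans (mul_le_mul_of_nonneg_left ?_ hΛ)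
      rwa [mem_closedBall_iff_norm] at hz)
    (Metric.mem_closedBall_self (norm_nonneg _)) (mem_closedBall_iff_norm.2 le_rfl)
  rw [← inner_gradient_eq_fderiv, Real.norm_eq_abs] at h
  have := (abs_le.1 h).2
  nlinarith

theorem abs_smoothed_le (hF : ∀ x, |F x| ≤ C) (θ : Vec d) : |smoothed F μ θ| ≤ C := by
  have := norm_integral_le_of_norm_le_const (μ := unifBall d) (f := fun b => F (θ + μ • b))
    (.of_forall fun b => hF _)
  simpa [smoothed] using this

theorem norm_smoothedGrad_sub_le
    (hG : ∀ x y, ‖gradient F x - gradient F y‖ ≤ Λ * ‖x - y‖) (x y : Vec d) :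
    ‖smoothedGrad F μ x - smoothedGrad F μ y‖ ≤ Λ * ‖x - y‖ := by
  have hc := continuous_of_norm_sub_le_mul hG
  rw [smoothedGrad, smoothedGrad, ← integral_sub (integrable_unifBall (by fun_prop))
    (integrable_unifBall (by fun_prop))]
  have := norm_integral_le_of_norm_le_const (μ := unifBall d)
    (f := fun b => gradient F (x + μ • b) - gradient F (y + μ • b)) (C := Λ * ‖x - y‖)
    (.of_forall fun b => (hG _ _).trans_eq (by simp))
  simpa using this

theorem norm_gradient_sub_smoothedGrad_le
    (hG : ∀ x y, ‖gradient F x - gradient F y‖ ≤ Λ * ‖x - y‖) (hΛ : 0 ≤ Λ) (hμ : 0 ≤ μ)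
    (x : Vec d) : ‖gradient F x - smoothedGrad F μ x‖ ≤ Λ * μ := by
  have hc := continuous_of_norm_sub_le_mul hG
  have h0 : gradient F x - smoothedGrad F μ x
      = ∫ b, (gradient F x - gradient F (x + μ • b)) ∂unifBall d := by
    rw [integral_sub (integrable_const _) (integrable_unifBall (by fun_prop))]
    simp [smoothedGrad]
  rw [h0]
  have := norm_integral_le_of_norm_le_const (μ := unifBall d)
    (f := fun b => gradient F x - gradient F (x + μ • b)) (C := Λ * μ) (by
      filter_upwards [ae_norm_le_one_unifBall d] with b hb
      refine (hG _ _).trans (mul_le_mul_of_nonneg_left ?_ hΛ)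
      rw [sub_add_cancel_left, norm_neg, norm_smul, Real.norm_of_nonneg hμ]
      exact mul_le_of_le_one_right hμ hb)
  simpa using this

theorem smoothed_le_add_inner_smoothedGrad (hF : Differentiable ℝ F)
    (hG : ∀ x y, ‖gradient F x - gradient F y‖ ≤ Λ * ‖x - y‖) (hΛ : 0 ≤ Λ) (x y : Vec d) :
    smoothed F μ y ≤ smoothed F μ x + inner ℝ (smoothedGrad F μ x) (y - x)
      + Λ * ‖y - x‖ ^ 2 := by
  have hc := continuous_of_norm_sub_le_mul hG
  have hFc := hF.continuous
  have i1 : Integrable (fun b => F (x + μ • b)) (unifBall d) := integrable_unifBall (by fun_prop)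
  have i2 : Integrable (fun b => gradient F (x + μ • b)) (unifBall d) :=
    integrable_unifBall (by fun_prop)
  have i3 : Integrable (fun b => inner ℝ (gradient F (x + μ • b)) (y - x)) (unifBall d) :=
    integrable_unifBall (by fun_prop)
  have h1 : inner ℝ (smoothedGrad F μ x) (y - x)
      = ∫ b, inner ℝ (gradient F (x + μ • b)) (y - x) ∂unifBall d := by
    rw [real_inner_comm, smoothedGrad, ← integral_inner i2]
    simp only [real_inner_comm]
  have h2 : smoothed F μ x + inner ℝ (smoothedGrad F μ x) (y - x) + Λ * ‖y - x‖ ^ 2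
      = ∫ b, (F (x + μ • b) + inner ℝ (gradient F (x + μ • b)) (y - x) + Λ * ‖y - x‖ ^ 2)
        ∂unifBall d := by
    rw [integral_add (f := fun b => F (x + μ • b) + inner ℝ (gradient F (x + μ • b)) (y - x))
      (i1.add i3) (integrable_const _), integral_add i1 i3, h1]
    simp [smoothed]
  rw [h2]
  refine integral_mono (integrable_unifBall (by fun_prop)) ((i1.add i3).add (integrable_const _))
    fun b => ?_
  have := le_add_inner_gradient hF hG hΛ (x + μ • b) (y + μ • b)
  simpa using this

/-- The gradient of the ball average is a weighted spherical average of finite differences. -/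
theorem smoothedGrad_eq_integral_unifSphere (hd : 0 < d) (hF : Differentiable ℝ F)
    (hG : Continuous (gradient F)) (hμ : 0 < μ) (θ : Vec d) :
    smoothedGrad F μ θ
      = (d : ℝ) • ∫ u, ((F (θ + μ • u) - F θ) / μ) • u ∂unifSphere d := by
  have := isProbabilityMeasure_unifSphere hd
  have hF1 := contDiff_one_of_gradient_continuous hF hG
  have hFc := hF.continuous
  set q : Vec d → ℝ := fun x => (F (θ + μ • x) - F θ) / μ with hq
  have hqd : ContDiff ℝ 1 q := by
    rw [hq]
    have : ContDiff ℝ 1 fun x : Vec d => θ + μ • x := by fun_prop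
    exact ((hF1.comp this).sub contDiff_const).div_const μ
  have hfd : ∀ x v, fderiv ℝ q x v = inner ℝ (gradient F (θ + μ • x)) v := fun x v => by
    have h1 : HasFDerivAt (fun x : Vec d => θ + μ • x) (μ • ContinuousLinearMap.id ℝ (Vec d)) x :=
      ((hasFDerivAt_id x).const_smul μ).const_add θ
    have h2 := (((hF (θ + μ • x)).hasFDerivAt.comp x h1).sub_const (F θ)).const_mul μ⁻¹
    have h3 : HasFDerivAt q (μ⁻¹ • (fderiv ℝ F (θ + μ • x)).comp
        (μ • ContinuousLinearMap.id ℝ (Vec d))) x := by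
      refine h2.congr_of_eventuallyEq (.of_forall fun y => ?_)
      simp [hq, div_eq_inv_mul]
    rw [h3.fderiv, inner_gradient_eq_fderiv]
    simp [hμ.ne']
  have i2 : Integrable (fun b => gradient F (θ + μ • b)) (unifBall d) :=
    integrable_unifBall (by fun_prop)
  have i4 : Integrable (fun u => q u • u) (unifSphere d) := by
    obtain ⟨M, hM⟩ := (isCompact_sphere (0 : Vec d) 1).exists_bound_of_continuousOn
      (f := fun u => q u • u) (by have := hqd.continuous; fun_prop)
    refine Integrable.of_bound (by have := hqd.continuous; fun_prop) M ?_
    filter_upwards [ae_norm_eq_one_unifSphere d] with u hu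
    exact hM u (by simpa using hu)
  refine ext_inner_left ℝ fun v => ?_
  rw [smoothedGrad, ← integral_inner i2, inner_smul_right, ← integral_inner i4]
  have := integral_unifBall_fderiv hd hqd v
  simp only [hfd] at this
  simp only [inner_smul_right, real_inner_comm] at this ⊢
  exact this

end Smoothing

/-! ### Comparison of the denominators -/

section Denominators

variable {β₂ ζ v m : ℝ}

/-- Replacing the denominator that contains the fresh moment estimate `m` by its predictable
version costs at most a multiple of `(1 - β₂) m² / (v' + ζ)`, whose time average is bounded. -/
theorem abs_inv_sqrt_sub_inv_sqrt_succ_le (hζ : 0 < ζ) (hβ : 0 ≤ β₂) (hβ' : β₂ ≤ 1) (hv : 0 ≤ v) :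
    |(√(β₂ * v + ζ))⁻¹ - (√(β₂ * v + (1 - β₂) * m ^ 2 + ζ))⁻¹|
      ≤ (1 - β₂) / √ζ * (m / √(β₂ * v + (1 - β₂) * m ^ 2 + ζ)) ^ 2 := by
  have hδ : 0 ≤ 1 - β₂ := by linarith
  have hβv : 0 ≤ β₂ * v := by positivity
  have hδm : 0 ≤ (1 - β₂) * m ^ 2 := by positivity
  set D := √(β₂ * v + ζ) with hD
  set R := √(β₂ * v + (1 - β₂) * m ^ 2 + ζ) with hR
  have hD2 : D ^ 2 = β₂ * v + ζ := Real.sq_sqrt (by positivity)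
  have hR2 : R ^ 2 = β₂ * v + (1 - β₂) * m ^ 2 + ζ := Real.sq_sqrt (by positivity)
  have hz : 0 < √ζ := Real.sqrt_pos.2 hζ
  have hDz : √ζ ≤ D := Real.sqrt_le_sqrt (by linarith)
  have hDR : D ≤ R := Real.sqrt_le_sqrt (by linarith)
  have hD0 : 0 < D := hz.trans_le hDz
  have hR0 : 0 < R := hD0.trans_le hDR
  rw [abs_of_nonneg (sub_nonneg.2 (inv_anti₀ hD0 hDR))]
  have h1 : D⁻¹ - R⁻¹ = (1 - β₂) * m ^ 2 / ((R + D) * D * R) := by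
    have : (R + D) * (R - D) = (1 - β₂) * m ^ 2 := by linear_combination hR2 - hD2
    rw [← this]
    field_simp
  have h2 : (1 - β₂) / √ζ * (m / R) ^ 2 = (1 - β₂) * m ^ 2 / (R * √ζ * R) := by
    field_simp
  rw [h1, h2]
  gcongr
  linarith

theorem abs_inv_sqrt_sub_inv_sqrt_mul_le (hζ : 0 < ζ) (hβ : 0 ≤ β₂) (hβ' : β₂ ≤ 1) (hv : 0 ≤ v) :
    |(√(v + ζ))⁻¹ - (√(β₂ * v + ζ))⁻¹| ≤ (1 - β₂) / √ζ := by
  have hδ : 0 ≤ 1 - β₂ := by linarith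
  have hβv : 0 ≤ β₂ * v := by positivity
  have hβv' : β₂ * v ≤ v := mul_le_of_le_one_left hv hβ'
  set D := √(β₂ * v + ζ) with hD
  set R := √(v + ζ) with hR
  have hD2 : D ^ 2 = β₂ * v + ζ := Real.sq_sqrt (by positivity)
  have hR2 : R ^ 2 = v + ζ := Real.sq_sqrt (by positivity)
  have hz : 0 < √ζ := Real.sqrt_pos.2 hζ
  have hDz : √ζ ≤ D := Real.sqrt_le_sqrt (by linarith)
  have hDR : D ≤ R := Real.sqrt_le_sqrt (by linarith)
  have hD0 : 0 < D := hz.trans_le hDz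
  have hR0 : 0 < R := hD0.trans_le hDR
  rw [abs_sub_comm, abs_of_nonneg (sub_nonneg.2 (inv_anti₀ hD0 hDR))]
  have h1 : D⁻¹ - R⁻¹ = (1 - β₂) * v / ((R + D) * D * R) := by
    have : (R + D) * (R - D) = (1 - β₂) * v := by linear_combination hR2 - hD2
    rw [← this]
    field_simp
  have h2 : (1 - β₂) / √ζ = (1 - β₂) * R ^ 2 / (R * √ζ * R) := by
    field_simp
  rw [h1, h2]
  gcongr <;> linarith

theorem inv_sqrt_mul_le_two_mul_inv_sqrt (hζ : 0 < ζ) (hβ : 1 / 2 ≤ β₂) (hv : 0 ≤ v) :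
    (√(β₂ * v + ζ))⁻¹ ≤ 2 * (√(v + ζ))⁻¹ := by
  have h : √(v + ζ) ≤ 2 * √(β₂ * v + ζ) := by
    rw [Real.sqrt_le_left (by positivity), mul_pow, Real.sq_sqrt (by positivity)]
    nlinarith
  have h1 : 0 < √(v + ζ) := Real.sqrt_pos.2 (by positivity)
  have h2 : 0 < √(β₂ * v + ζ) := Real.sqrt_pos.2 (by positivity)
  rw [← div_eq_mul_inv, inv_eq_one_div, div_le_div_iff₀ h2 h1]
  linarith

/-- The logarithm of the second moment estimate absorbs the normalized first moment. -/
theorem mul_sq_div_sqrt_le_log_sub_log (hζ : 0 < ζ) (hβ : 1 / 2 ≤ β₂) (hβ' : β₂ < 1)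
    (hv : 0 ≤ v) :
    (1 - β₂) * (m / √(β₂ * v + (1 - β₂) * m ^ 2 + ζ)) ^ 2
      ≤ Real.log (β₂ * v + (1 - β₂) * m ^ 2 + ζ) - Real.log (v + ζ) + 2 * (1 - β₂) := by
  have hδ : 0 < 1 - β₂ := by linarith
  have hβ0 : 0 < β₂ := by linarith
  have hx : 0 < β₂ * v + (1 - β₂) * m ^ 2 + ζ := by positivity
  have hy : 0 < v + ζ := by positivity
  rw [div_pow, Real.sq_sqrt hx.le]
  set x := β₂ * v + (1 - β₂) * m ^ 2 + ζ with hxdef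
  have h1 : Real.log (β₂ * (v + ζ) / x) ≤ β₂ * (v + ζ) / x - 1 :=
    Real.log_le_sub_one_of_pos (by positivity)
  rw [Real.log_div (by positivity) hx.ne', Real.log_mul hβ0.ne' hy.ne'] at h1
  have h2 : -Real.log β₂ ≤ 2 * (1 - β₂) := by
    have := Real.log_le_sub_one_of_pos (inv_pos.2 hβ0)
    rw [Real.log_inv] at this
    have h3 : β₂⁻¹ - 1 = (1 - β₂) / β₂ := by field_simp
    have h4 : (1 - β₂) / β₂ ≤ 2 * (1 - β₂) := by
      rw [div_le_iff₀ hβ0]; nlinarith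
    linarith
  have h3 : (1 - β₂) * (m ^ 2 / x) ≤ 1 - β₂ * (v + ζ) / x := by
    rw [← mul_div_assoc, le_sub_iff_add_le, ← add_div, div_le_one hx]
    nlinarith
  linarith

end Denominators

/-! ### Energy inequality along a run -/

section Step

variable {d : ℕ}

theorem sum_abs_mul_abs_le (x y : Vec d) : ∑ i, |x i| * |y i| ≤ ‖x‖ * ‖y‖ := by
  have := Real.sum_mul_le_sqrt_mul_sqrt Finset.univ (fun i => |x i|) (fun i => |y i|)
  simpa [EuclideanSpace.norm_eq] using this

theorem abs_apply_le_norm (x : Vec d) (i : Fin d) : |x i| ≤ ‖x‖ := by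
  simpa using PiLp.norm_apply_le x i

/-- One iteration of R-AdaZO with gradient estimate `g`. -/
noncomputable def step (β₁ β₂ ζ η : ℝ) (s : State d) (g : Vec d) : State d :=
  ⟨nextθ β₁ β₂ ζ η s g, nextM β₁ s g, nextV β₁ β₂ s g⟩

/-- The vector `x / √(β₂ v + ζ)` (coordinatewise): its denominator, unlike `√(v' + ζ)` with the
next second moment estimate `v'`, does not depend on the next gradient estimate. -/
noncomputable def precond (β₂ ζ : ℝ) (s : State d) (x : Vec d) : Vec d :=
  WithLp.toLp 2 fun i => x i * (√(β₂ * s.v i + ζ))⁻¹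

theorem norm_precond_le {β₂ ζ : ℝ} (hζ : 0 < ζ) (hβ : 0 ≤ β₂) {s : State d} (hv : ∀ i, 0 ≤ s.v i)
    (x : Vec d) : ‖precond β₂ ζ s x‖ ≤ ‖x‖ / √ζ := by
  have hz : 0 < √ζ := Real.sqrt_pos.2 hζ
  rw [div_eq_mul_inv, mul_comm, ← Real.norm_of_nonneg (inv_nonneg.2 hz.le), ← norm_smul,
    EuclideanSpace.norm_eq, EuclideanSpace.norm_eq]
  refine Real.sqrt_le_sqrt (Finset.sum_le_sum fun i _ => ?_)
  have h0 : 0 ≤ β₂ * s.v i := mul_nonneg hβ (hv i)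
  have h1 : (√(β₂ * s.v i + ζ))⁻¹ ≤ (√ζ)⁻¹ := inv_anti₀ hz (Real.sqrt_le_sqrt (by linarith))
  simp only [precond, PiLp.smul_apply, smul_eq_mul, norm_mul, Real.norm_eq_abs]
  rw [abs_of_nonneg (inv_nonneg.2 (Real.sqrt_nonneg _)), abs_of_pos (inv_pos.2 hz),
    mul_comm (√ζ)⁻¹]
  gcongr

/-- The energy `-(1 - β₁) H(θ) / η + β₁ ⟪G(θ), m / √(β₂ v + ζ)⟫ + c ∑ᵢ log (vᵢ + ζ)`. The inner
product accounts for the momentum, the logarithms for the normalized squared steps. -/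
noncomputable def energy (β₁ β₂ ζ η c : ℝ) (H : Vec d → ℝ) (G : Vec d → Vec d) (s : State d) : ℝ :=
  -(1 - β₁) * H s.θ / η + β₁ * inner ℝ (G s.θ) (precond β₂ ζ s s.m)
    + c * ∑ i, Real.log (s.v i + ζ)

theorem inner_precond_le_energy_sub {β₁ β₂ ζ η B Λ : ℝ} (hβ₁ : 0 ≤ β₁) (hβ₁' : β₁ ≤ 1)
    (hβ₂ : 1 / 2 ≤ β₂) (hβ₂' : β₂ < 1) (hζ : 0 < ζ) (hη : 0 < η) (hB : 0 ≤ B) (hΛ : 0 ≤ Λ)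
    {H : Vec d → ℝ} {G : Vec d → Vec d} (hG : ∀ x, ‖G x‖ ≤ B)
    (hGΛ : ∀ x y, ‖G x - G y‖ ≤ Λ * ‖x - y‖)
    (hH : ∀ x y, H y ≤ H x + inner ℝ (G x) (y - x) + Λ * ‖y - x‖ ^ 2)
    {s : State d} {g : Vec d} (hv : ∀ i, 0 ≤ s.v i) (hm : ‖(step β₁ β₂ ζ η s g).m‖ ≤ B)
    {Z : ℝ} (hZ : Z = 2 * Λ * η + (1 - β₂) * (B ^ 2 / √ζ)) :
    (1 - β₁) * inner ℝ (precond β₂ ζ s (G s.θ)) g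
      ≤ energy β₁ β₂ ζ η (Z / (1 - β₂)) H G (step β₁ β₂ ζ η s g)
        - energy β₁ β₂ ζ η (Z / (1 - β₂)) H G s
        + (2 * d * Z + β₁ * ((1 - β₂) * (B ^ 2 / √ζ))) := by
  have hδ : 0 < 1 - β₂ := by linarith
  have hβ₂0 : 0 ≤ β₂ := by linarith
  have hz : 0 < √ζ := Real.sqrt_pos.2 hζ
  set δ := 1 - β₂ with hδdef
  set s' := step β₁ β₂ ζ η s g with hs'
  have hv' : ∀ i, s'.v i = β₂ * s.v i + δ * s'.m i ^ 2 := fun i => rfl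
  have hv0 : ∀ i, 0 ≤ s'.v i := fun i => by rw [hv']; have := hv i; positivity
  have hm' : ∀ i, s'.m i = β₁ * s.m i + (1 - β₁) * g i := fun i => by
    simp [hs', step, nextM]
  set w : Vec d := WithLp.toLp 2 fun i => s'.m i / √(s'.v i + ζ) with hw
  have hwi : ∀ i, w i = s'.m i * (√(s'.v i + ζ))⁻¹ := fun i => div_eq_mul_inv _ _
  have hN : ‖w‖ ^ 2 = ∑ i, w i ^ 2 := by
    rw [EuclideanSpace.norm_sq_eq]; simp
  have hΔ : s'.θ - s.θ = -η • w := by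
    ext i
    simp [hs', step, nextθ, hw]
  set A := B ^ 2 / √ζ with hA
  have hA0 : 0 ≤ A := by positivity
  set q : ℝ := ∑ i, G s.θ i * w i with hq
  have hcoord : ∀ x y : Vec d, (inner ℝ x y : ℝ) = ∑ i, x i * y i := fun x y => by
    simp [PiLp.inner_apply, mul_comm]
  -- The descent of `H`.
  have h1 : q ≤ (H s.θ - H s'.θ) / η + Λ * η * ‖w‖ ^ 2 := by
    have h := hH s.θ s'.θ
    rw [hΔ, inner_smul_right, norm_smul, mul_pow, Real.norm_eq_abs, sq_abs, hcoord, ← hq] at h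
    rw [← sub_le_iff_le_add, le_div_iff₀ hη]
    nlinarith
  -- The predictable denominators against the actual ones.
  have h2 : ∑ i, G s.θ i * s'.m i * (√(β₂ * s.v i + ζ))⁻¹ ≤ q + δ * A * ‖w‖ ^ 2 := by
    rw [hq, hN, Finset.mul_sum, ← Finset.sum_add_distrib]
    refine Finset.sum_le_sum fun i _ => ?_
    have h := abs_inv_sqrt_sub_inv_sqrt_succ_le (m := s'.m i) hζ hβ₂0 hβ₂'.le (hv i)
    rw [← hδdef, ← hv' i] at h
    have hGm : |G s.θ i * s'.m i| ≤ B ^ 2 := by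
      rw [abs_mul, sq]
      exact mul_le_mul ((abs_apply_le_norm _ i).trans (hG _))
        ((abs_apply_le_norm _ i).trans hm) (abs_nonneg _) hB
    have h3 := le_abs_self (G s.θ i * s'.m i *
      ((√(β₂ * s.v i + ζ))⁻¹ - (√(s'.v i + ζ))⁻¹))
    rw [abs_mul] at h3
    have h4 := mul_le_mul hGm h (abs_nonneg _) (sq_nonneg B)
    have h5 : B ^ 2 * (δ / √ζ * (s'.m i / √(s'.v i + ζ)) ^ 2) = δ * A * w i ^ 2 := by
      rw [hwi, hA]; ring
    rw [h5] at h4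
    have h6 : G s.θ i * w i = G s.θ i * s'.m i * (√(s'.v i + ζ))⁻¹ := by rw [hwi]; ring
    rw [mul_sub] at h3
    linarith
  -- The momentum term of the next state.
  have h3 : q ≤ inner ℝ (G s'.θ) (precond β₂ ζ s' s'.m) + 2 * Λ * η * ‖w‖ ^ 2 + δ * A := by
    have e1 : ∑ i, (G s.θ i - G s'.θ i) * (s'.m i * (√(β₂ * s'.v i + ζ))⁻¹)
        ≤ 2 * Λ * η * ‖w‖ ^ 2 := by
      calc _ ≤ ∑ i, 2 * (|(G s.θ - G s'.θ) i| * |w i|) := by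
            refine Finset.sum_le_sum fun i _ => ?_
            refine (le_abs_self _).trans ?_
            rw [abs_mul, PiLp.sub_apply, mul_left_comm]
            refine mul_le_mul_of_nonneg_left ?_ (abs_nonneg _)
            rw [hwi, abs_mul, abs_mul, abs_of_nonneg (inv_nonneg.2 (Real.sqrt_nonneg _)),
              abs_of_nonneg (inv_nonneg.2 (Real.sqrt_nonneg _)), mul_left_comm]
            exact mul_le_mul_of_nonneg_left
              (inv_sqrt_mul_le_two_mul_inv_sqrt hζ hβ₂ (hv0 i)) (abs_nonneg _)
        _ ≤ 2 * (‖G s.θ - G s'.θ‖ * ‖w‖) := by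
            rw [← Finset.mul_sum]
            exact mul_le_mul_of_nonneg_left (sum_abs_mul_abs_le _ _) two_pos.le
        _ ≤ 2 * ((Λ * (η * ‖w‖)) * ‖w‖) := by
            gcongr
            refine (hGΛ _ _).trans_eq ?_
            rw [norm_sub_rev, hΔ, norm_smul, norm_neg, Real.norm_of_nonneg hη.le]
        _ = _ := by ring
    have e2 : ∑ i, G s.θ i * s'.m i * ((√(s'.v i + ζ))⁻¹ - (√(β₂ * s'.v i + ζ))⁻¹) ≤ δ * A := by
      calc _ ≤ ∑ i, (|G s.θ i| * |s'.m i|) * (δ / √ζ) := by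
            refine Finset.sum_le_sum fun i _ => (le_abs_self _).trans ?_
            rw [abs_mul, abs_mul]
            exact mul_le_mul_of_nonneg_left
              (abs_inv_sqrt_sub_inv_sqrt_mul_le hζ hβ₂0 hβ₂'.le (hv0 i)) (by positivity)
        _ ≤ (B * B) * (δ / √ζ) := by
            rw [← Finset.sum_mul]
            refine mul_le_mul_of_nonneg_right ?_ (by positivity)
            exact (sum_abs_mul_abs_le _ _).trans (mul_le_mul (hG _) hm (norm_nonneg _) hB)
        _ = _ := by rw [hA]; ring
    have e3 : q = inner ℝ (G s'.θ) (precond β₂ ζ s' s'.m)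
        + ∑ i, (G s.θ i - G s'.θ i) * (s'.m i * (√(β₂ * s'.v i + ζ))⁻¹)
        + ∑ i, G s.θ i * s'.m i * ((√(s'.v i + ζ))⁻¹ - (√(β₂ * s'.v i + ζ))⁻¹) := by
      rw [hcoord, ← Finset.sum_add_distrib, ← Finset.sum_add_distrib, hq]
      refine Finset.sum_congr rfl fun i _ => ?_
      rw [hwi]
      simp only [precond]
      ring
    linarith
  -- The logarithms absorb the normalized squared step.
  have h4 : δ * ‖w‖ ^ 2 ≤ ∑ i, Real.log (s'.v i + ζ) - ∑ i, Real.log (s.v i + ζ)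
      + 2 * d * δ := by
    have : ∑ i : Fin d, (2 * δ) = 2 * d * δ := by simp; ring
    rw [hN, Finset.mul_sum, ← this, ← Finset.sum_sub_distrib, ← Finset.sum_add_distrib]
    refine Finset.sum_le_sum fun i _ => ?_
    have h := mul_sq_div_sqrt_le_log_sub_log (m := s'.m i) hζ hβ₂ hβ₂' (hv i)
    rwa [← hδdef, ← hv' i] at h
  have h5 : (1 - β₁) * inner ℝ (precond β₂ ζ s (G s.θ)) g
      = ∑ i, G s.θ i * s'.m i * (√(β₂ * s.v i + ζ))⁻¹
        - β₁ * inner ℝ (G s.θ) (precond β₂ ζ s s.m) := by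
    rw [hcoord, hcoord, Finset.mul_sum, Finset.mul_sum, ← Finset.sum_sub_distrib]
    refine Finset.sum_congr rfl fun i _ => ?_
    rw [hm']
    simp only [precond]
    ring
  have hZ0 : 0 ≤ Z := by rw [hZ]; positivity
  have h6 : Z * ‖w‖ ^ 2 ≤ Z / δ * (∑ i, Real.log (s'.v i + ζ) - ∑ i, Real.log (s.v i + ζ))
      + 2 * d * Z := by
    have h := mul_le_mul_of_nonneg_left h4 (div_nonneg hZ0 hδ.le)
    have e1 : Z / δ * (δ * ‖w‖ ^ 2) = Z * ‖w‖ ^ 2 := by field_simp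
    have e2 : Z / δ * (2 * d * δ) = 2 * d * Z := by field_simp
    rw [mul_add, e1, e2] at h
    exact h
  have h7 := mul_le_mul_of_nonneg_left h1 (sub_nonneg.2 hβ₁')
  have h8 := mul_le_mul_of_nonneg_left h3 hβ₁
  have h9 : (1 - β₁) * (Λ * η * ‖w‖ ^ 2) + β₁ * (2 * Λ * η * ‖w‖ ^ 2) + δ * A * ‖w‖ ^ 2
      ≤ Z * ‖w‖ ^ 2 := by
    have : 0 ≤ Λ * η * ‖w‖ ^ 2 := by positivity
    rw [hZ]
    nlinarith
  simp only [energy]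
  rw [h5]
  have e : (1 - β₁) * ((H s.θ - H s'.θ) / η)
      = -(1 - β₁) * H s'.θ / η - -(1 - β₁) * H s.θ / η := by ring
  nlinarith

end Step

/-! ### Bounds and measurability along a run -/

section Run

variable {d K : ℕ} {Ξ : Type*} {f : Vec d → Ξ → ℝ} {μ β₁ β₂ ζ η B C : ℝ} {θ₀ v₀ : Vec d}

theorem run_succ (z : ℕ → Ξ) (u : ℕ → Fin K → Vec d) (t : ℕ) :
    run f μ β₁ β₂ ζ η θ₀ v₀ z u (t + 1) = step β₁ β₂ ζ η (run f μ β₁ β₂ ζ η θ₀ v₀ z u t)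
      (zoGrad f μ (run f μ β₁ β₂ ζ η θ₀ v₀ z u t).θ (z t) (u t)) := rfl

theorem norm_zoGrad_le (hK : 0 < K) (hμ : 0 < μ) (hf : ∀ θ z, |f θ z| ≤ C) (θ : Vec d) (z : Ξ)
    {u : Fin K → Vec d} (hu : ∀ k, ‖u k‖ ≤ 1) : ‖zoGrad f μ θ z u‖ ≤ 2 * C * d / μ := by
  have hC : 0 ≤ C := (abs_nonneg _).trans (hf θ z)
  have hK' : (0 : ℝ) < K := by exact_mod_cast hK
  have h : ∀ k, ‖((f (θ + μ • u k) z - f θ z) / μ) • u k‖ ≤ 2 * C / μ := fun k => by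
    rw [norm_smul, norm_div, Real.norm_of_nonneg hμ.le, Real.norm_eq_abs]
    refine (mul_le_of_le_one_right (by positivity) (hu k)).trans ?_
    gcongr
    refine (abs_sub _ _).trans ?_
    linarith [hf (θ + μ • u k) z, hf θ z]
  rw [zoGrad, norm_smul, Real.norm_of_nonneg (by positivity)]
  calc (d : ℝ) / K * ‖∑ k, ((f (θ + μ • u k) z - f θ z) / μ) • u k‖
      ≤ d / K * ∑ _k : Fin K, 2 * C / μ := by
        gcongr
        exact norm_sum_le_of_le _ fun k _ => h k
    _ = 2 * C * d / μ := by
        simp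
        field_simp

theorem run_bounds (hβ₁ : 0 ≤ β₁) (hβ₁' : β₁ ≤ 1) (hβ₂ : 0 ≤ β₂) (hβ₂' : β₂ ≤ 1) (hB : 0 ≤ B)
    (hv₀ : ∀ i, 0 ≤ v₀ i) (z : ℕ → Ξ) (u : ℕ → Fin K → Vec d)
    (hg : ∀ t, ‖zoGrad f μ (run f μ β₁ β₂ ζ η θ₀ v₀ z u t).θ (z t) (u t)‖ ≤ B) (t : ℕ) :
    ‖(run f μ β₁ β₂ ζ η θ₀ v₀ z u t).m‖ ≤ B ∧
      ∀ i, 0 ≤ (run f μ β₁ β₂ ζ η θ₀ v₀ z u t).v i ∧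
        (run f μ β₁ β₂ ζ η θ₀ v₀ z u t).v i ≤ v₀ i + B ^ 2 := by
  induction t with
  | zero => exact ⟨by simpa [run] using hB, fun i => ⟨hv₀ i, by simp [run, sq_nonneg]⟩⟩
  | succ t ih =>
    obtain ⟨hm, hv⟩ := ih
    have hm' : ‖(run f μ β₁ β₂ ζ η θ₀ v₀ z u (t + 1)).m‖ ≤ B := by
      rw [run_succ]
      refine (norm_add_le _ _).trans ?_
      rw [norm_smul, norm_smul, Real.norm_of_nonneg hβ₁, Real.norm_of_nonneg (sub_nonneg.2 hβ₁')]
      have h1 := mul_le_mul_of_nonneg_left hm hβ₁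
      have h2 := mul_le_mul_of_nonneg_left (hg t) (sub_nonneg.2 hβ₁')
      linarith
    refine ⟨hm', fun i => ?_⟩
    have hvi : (run f μ β₁ β₂ ζ η θ₀ v₀ z u (t + 1)).v i
        = β₂ * (run f μ β₁ β₂ ζ η θ₀ v₀ z u t).v i
          + (1 - β₂) * (run f μ β₁ β₂ ζ η θ₀ v₀ z u (t + 1)).m i ^ 2 := rfl
    have h1 : (run f μ β₁ β₂ ζ η θ₀ v₀ z u (t + 1)).m i ^ 2 ≤ B ^ 2 :=
      sq_le_sq' (abs_le.1 ((abs_apply_le_norm _ i).trans hm')).1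
        (abs_le.1 ((abs_apply_le_norm _ i).trans hm')).2
    have hδ := sub_nonneg.2 hβ₂'
    have h2 := mul_le_mul_of_nonneg_left h1 hδ
    have h3 := mul_le_mul_of_nonneg_left (hv i).2 hβ₂
    have h4 := mul_nonneg hδ (hv₀ i)
    rw [hvi]
    refine ⟨add_nonneg (mul_nonneg hβ₂ (hv i).1) (mul_nonneg hδ (sq_nonneg _)), ?_⟩
    linarith

variable {Ω : Type*} [MeasurableSpace Ξ] [MeasurableSpace Ω]

theorem measurable_zoGrad (hf : Measurable (Function.uncurry f)) {θ : Ω → Vec d} {z : Ω → Ξ}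
    {u : Fin K → Ω → Vec d} (hθ : Measurable θ) (hz : Measurable z) (hu : ∀ k, Measurable (u k)) :
    Measurable fun ω => zoGrad f μ (θ ω) (z ω) fun k => u k ω := by
  unfold zoGrad
  have hsum : ∀ k, Measurable fun ω =>
      ((f (θ ω + μ • u k ω) (z ω) - f (θ ω) (z ω)) / μ) • u k ω := fun k => by
    have h1 : Measurable fun ω => f (θ ω + μ • u k ω) (z ω) :=
      hf.comp ((hθ.add ((hu k).const_smul μ)).prodMk hz)
    have h2 : Measurable fun ω => f (θ ω) (z ω) := hf.comp (hθ.prodMk hz)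
    exact ((h1.sub h2).div_const μ).smul (hu k)
  exact (Finset.measurable_fun_sum Finset.univ fun k _ => hsum k).const_smul ((d : ℝ) / K)

theorem measurable_toLp {g : Fin d → Ω → ℝ} (hg : ∀ i, Measurable (g i)) :
    Measurable fun ω => (WithLp.toLp 2 fun i => g i ω : Vec d) :=
  (PiLp.continuous_toLp 2 _).measurable.comp (measurable_pi_lambda _ hg)

theorem measurable_apply {x : Ω → Vec d} (hx : Measurable x) (i : Fin d) :
    Measurable fun ω => x ω i :=
  (EuclideanSpace.proj (𝕜 := ℝ) i).continuous.measurable.comp hx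

/-- The state after `t` iterations is a measurable function of the samples of these iterations. -/
theorem measurable_run (hf : Measurable (Function.uncurry f)) {ξ : ℕ → Ω → Ξ}
    {u : ℕ → Fin K → Ω → Vec d} (t : ℕ) (hξ : ∀ s < t, Measurable (ξ s))
    (hu : ∀ s < t, ∀ k, Measurable (u s k)) :
    Measurable (fun ω =>
        (run f μ β₁ β₂ ζ η θ₀ v₀ (fun s => ξ s ω) (fun s k => u s k ω) t).θ) ∧
      Measurable (fun ω =>
        (run f μ β₁ β₂ ζ η θ₀ v₀ (fun s => ξ s ω) (fun s k => u s k ω) t).m) ∧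
      Measurable (fun ω =>
        (run f μ β₁ β₂ ζ η θ₀ v₀ (fun s => ξ s ω) (fun s k => u s k ω) t).v) := by
  induction t with
  | zero => exact ⟨measurable_const, measurable_const, measurable_const⟩
  | succ t ih =>
    obtain ⟨hθ, hm, hv⟩ := ih (fun s hs => hξ s (hs.trans t.lt_succ_self))
      (fun s hs => hu s (hs.trans t.lt_succ_self))
    have hg := measurable_zoGrad (μ := μ) hf hθ (hξ t t.lt_succ_self) (hu t t.lt_succ_self)
    have hm' := (hm.const_smul β₁).add (hg.const_smul (1 - β₁))
    have hv' : ∀ i, Measurable fun ω =>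
        (run f μ β₁ β₂ ζ η θ₀ v₀ (fun s => ξ s ω) (fun s k => u s k ω) (t + 1)).v i := fun i =>
      ((measurable_apply hv i).const_mul β₂).add
        (((measurable_apply hm' i).pow_const 2).const_mul (1 - β₂))
    refine ⟨?_, hm', measurable_toLp hv'⟩
    exact measurable_toLp fun i => (measurable_apply hθ i).sub
      (((measurable_apply hm' i).div ((hv' i).add_const ζ).sqrt).const_mul η)

theorem measurable_precond {s : Ω → State d} {x : Ω → Vec d} (hv : Measurable fun ω => (s ω).v)
    (hx : Measurable x) : Measurable fun ω => precond β₂ ζ (s ω) (x ω) :=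
  measurable_toLp fun i => (measurable_apply hx i).mul
    (((measurable_apply hv i).const_mul β₂).add_const ζ).sqrt.inv

end Run

/-! ### Conditional unbiasedness of the gradient estimator -/

section Independence

variable {d K : ℕ} {Ξ Ω : Type*} [MeasurableSpace Ξ] [MeasurableSpace Ω] {P : Measure Ξ}
  {Q : Measure Ω} {f : Vec d → Ξ → ℝ} {ξ : ℕ → Ω → Ξ} {u : ℕ → Fin K → Ω → Vec d}
  {μ β₁ β₂ ζ η : ℝ} {θ₀ v₀ : Vec d}

/-- The state after `t` iterations is independent of the sample of the next iteration. -/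
theorem IsSampling.indepFun_run (hs : IsSampling P Q ξ u) (hf : Measurable (Function.uncurry f))
    (t : ℕ) {G : Vec d → Vec d} (hG : Measurable G) :
    IndepFun (fun ω =>
        let s := run f μ β₁ β₂ ζ η θ₀ v₀ (fun s => ξ s ω) (fun s k => u s k ω) t
        (s.θ, precond β₂ ζ s (G s.θ)))
      (fun ω => (ξ t ω, fun k => u t k ω)) Q := by
  set X : ℕ → Ω → Ξ × (Fin K → Vec d) := fun t ω => (ξ t ω, fun k => u t k ω) with hX
  have hXm : ∀ t, Measurable (X t) := fun t =>
    (hs.measurable_ξ t).prodMk (measurable_pi_lambda _ fun k => hs.measurable_u t k)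
  have hind := indep_iSup_of_disjoint (m := fun t => MeasurableSpace.comap (X t) inferInstance)
    (fun t => (hXm t).comap_le) hs.indep (S := Set.Iio t) (T := {t}) (by simp)
  set 𝓕 : MeasurableSpace Ω :=
    ⨆ i ∈ Set.Iio t, MeasurableSpace.comap (X i) inferInstance with h𝓕
  have hXi : ∀ i < t, Measurable[𝓕] (X i) := fun i hi =>
    (comap_measurable (X i)).mono
      (le_iSup₂_of_le (f := fun i (_ : i ∈ Set.Iio t) =>
        MeasurableSpace.comap (X i) inferInstance) i hi le_rfl) le_rfl
  have hrun := @measurable_run d K Ξ f μ β₁ β₂ ζ η θ₀ v₀ Ω _ 𝓕 hf ξ u t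
    (fun i hi => measurable_fst.comp (hXi i hi))
    (fun i hi k => (measurable_pi_apply k).comp (measurable_snd.comp (hXi i hi)))
  have hW : Measurable[𝓕] (fun ω =>
      let s := run f μ β₁ β₂ ζ η θ₀ v₀ (fun s => ξ s ω) (fun s k => u s k ω) t
      (s.θ, precond β₂ ζ s (G s.θ))) :=
    hrun.1.prodMk (@measurable_precond d β₂ ζ Ω 𝓕 _ _ hrun.2.2 (hG.comp hrun.1))
  rw [IndepFun_iff_Indep]
  refine indep_of_indep_of_le_right (indep_of_indep_of_le_left hind hW.comap_le) ?_
  exact le_iSup₂_of_le (f := fun i (_ : i ∈ ({t} : Set ℕ)) =>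
    MeasurableSpace.comap (X i) inferInstance) t rfl le_rfl

end Independence

section Unbiased

variable {d K : ℕ} {Ξ : Type*} [MeasurableSpace Ξ] {P : Measure Ξ} [IsProbabilityMeasure P]
  {f : Vec d → Ξ → ℝ} {μ C Λ : ℝ}

theorem ae_norm_le_one_pi_unifSphere (hd : 0 < d) :
    ∀ᵐ x ∂P.prod (Measure.pi fun _ : Fin K => unifSphere d), ∀ k, ‖x.2 k‖ ≤ 1 := by
  have := isProbabilityMeasure_unifSphere hd
  refine ae_all_iff.2 fun k => ?_
  have hmp := (measurePreserving_eval (fun _ : Fin K => unifSphere d) k).comp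
    (measurePreserving_snd (μ := P) (ν := Measure.pi fun _ : Fin K => unifSphere d))
  exact hmp.quasiMeasurePreserving.ae
    ((ae_norm_eq_one_unifSphere d).mono fun u hu => hu.le)

theorem integrable_zoGrad (hd : 0 < d) (hK : 0 < K) (hμ : 0 < μ)
    (hf : Measurable (Function.uncurry f)) (hfC : ∀ θ z, |f θ z| ≤ C) (θ : Vec d) :
    Integrable (fun x : Ξ × (Fin K → Vec d) => zoGrad f μ θ x.1 x.2)
      (P.prod (Measure.pi fun _ : Fin K => unifSphere d)) := by
  have := isProbabilityMeasure_unifSphere hd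
  refine Integrable.of_bound (measurable_zoGrad hf measurable_const measurable_fst
    fun k => (measurable_pi_apply k).comp measurable_snd).aestronglyMeasurable (2 * C * d / μ) ?_
  filter_upwards [ae_norm_le_one_pi_unifSphere (P := P) hd] with x hx
  exact norm_zoGrad_le hK hμ hfC θ x.1 hx

theorem integral_zoGrad (hd : 0 < d) (hK : 0 < K) (hμ : 0 < μ)
    (hf : Measurable (Function.uncurry f)) (hfC : ∀ θ z, |f θ z| ≤ C)
    (hF : Differentiable ℝ (objective P f)) (hG : Continuous (gradient (objective P f)))
    (θ : Vec d) :
    ∫ x, zoGrad f μ θ x.1 x.2 ∂P.prod (Measure.pi fun _ : Fin K => unifSphere d)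
      = smoothedGrad (objective P f) μ θ := by
  have := isProbabilityMeasure_unifSphere hd
  have hK' : (K : ℝ) ≠ 0 := by positivity
  have hmeas : Measurable fun y : Ξ × Vec d => ((f (θ + μ • y.2) y.1 - f θ y.1) / μ) • y.2 := by
    have h1 : Measurable fun y : Ξ × Vec d => f (θ + μ • y.2) y.1 :=
      hf.comp ((measurable_const.add (measurable_snd.const_smul μ)).prodMk measurable_fst)
    have h2 : Measurable fun y : Ξ × Vec d => f θ y.1 :=
      hf.comp (measurable_const.prodMk measurable_fst)
    exact ((h1.sub h2).div_const μ).smul measurable_snd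
  have hint : Integrable (fun y : Ξ × Vec d => ((f (θ + μ • y.2) y.1 - f θ y.1) / μ) • y.2)
      (P.prod (unifSphere d)) := by
    refine Integrable.of_bound hmeas.aestronglyMeasurable (2 * C / μ) ?_
    have hae : ∀ᵐ y ∂P.prod (unifSphere d), ‖y.2‖ = 1 :=
      (measurePreserving_snd (μ := P) (ν := unifSphere d)).quasiMeasurePreserving.ae
        (ae_norm_eq_one_unifSphere d)
    filter_upwards [hae] with y hy
    rw [norm_smul, hy, mul_one, norm_div, Real.norm_of_nonneg hμ.le, Real.norm_eq_abs]
    gcongr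
    refine (abs_sub _ _).trans ?_
    linarith [hfC (θ + μ • y.2) y.1, hfC θ y.1]
  have hfi : ∀ θ, Integrable (f θ) P := fun θ =>
    Integrable.of_bound (hf.comp (measurable_const.prodMk measurable_id)).aestronglyMeasurable C
      (.of_forall fun z => hfC θ z)
  have hmp : ∀ k : Fin K, MeasurePreserving (fun x : Ξ × (Fin K → Vec d) => (x.1, x.2 k))
      (P.prod (Measure.pi fun _ : Fin K => unifSphere d)) (P.prod (unifSphere d)) := fun k =>
    (MeasurePreserving.id P).prod (measurePreserving_eval (fun _ : Fin K => unifSphere d) k)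
  have hone : ∀ k : Fin K, ∫ x, ((f (θ + μ • x.2 k) x.1 - f θ x.1) / μ) • x.2 k
        ∂P.prod (Measure.pi fun _ : Fin K => unifSphere d)
      = ∫ u, ((objective P f (θ + μ • u) - objective P f θ) / μ) • u ∂unifSphere d := fun k => by
    rw [← (hmp k).map_eq] at hint
    have h1 := integral_map (hmp k).measurable.aemeasurable hint.aestronglyMeasurable
    rw [(hmp k).map_eq] at h1 hint
    rw [← h1, integral_prod_symm _ hint]
    congr 1
    ext1 u
    dsimp only
    rw [integral_smul_const, integral_div, integral_sub (hfi _) (hfi _)]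
    rfl
  have hinti : ∀ k : Fin K, Integrable (fun x : Ξ × (Fin K → Vec d) =>
      ((f (θ + μ • x.2 k) x.1 - f θ x.1) / μ) • x.2 k)
      (P.prod (Measure.pi fun _ : Fin K => unifSphere d)) := fun k =>
    (hmp k).integrable_comp_of_integrable hint
  simp only [zoGrad]
  rw [integral_smul, integral_finsetSum _ fun k _ => hinti k, Finset.sum_congr rfl
    fun k _ => hone k, Finset.sum_const, Finset.card_univ, Fintype.card_fin,
    smoothedGrad_eq_integral_unifSphere hd hF hG hμ, ← Nat.cast_smul_eq_nsmul ℝ, smul_smul,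
    div_mul_cancel₀ _ hK']

variable {Ω : Type*} [MeasurableSpace Ω] {Q : Measure Ω}
  {ξ : ℕ → Ω → Ξ} {u : ℕ → Fin K → Ω → Vec d} {β₁ β₂ ζ η : ℝ} {θ₀ v₀ : Vec d}

theorem IsSampling.ae_norm_le_one (hs : IsSampling P Q ξ u) (hd : 0 < d) :
    ∀ᵐ ω ∂Q, ∀ t k, ‖u t k ω‖ ≤ 1 := by
  refine ae_all_iff.2 fun t => ?_
  have hm : Measurable fun ω => (ξ t ω, fun k => u t k ω) :=
    (hs.measurable_ξ t).prodMk (measurable_pi_lambda _ fun k => hs.measurable_u t k)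
  have h := ae_norm_le_one_pi_unifSphere (P := P) (K := K) hd
  rw [← hs.law t] at h
  exact ae_of_ae_map hm.aemeasurable h

variable [IsProbabilityMeasure Q]

/-- Unbiasedness: paired with the predictable direction `∇F_μ(θₜ) / √(β₂ vₜ + ζ)`, the gradient
estimate may be replaced by `∇F_μ(θₜ)` in expectation. -/
theorem IsSampling.integral_inner_zoGrad (hs : IsSampling P Q ξ u) (hd : 0 < d) (hK : 0 < K)
    (hμ : 0 < μ) (hζ : 0 < ζ) (hβ₂ : 0 ≤ β₂) (hf : Measurable (Function.uncurry f))
    (hfC : ∀ θ z, |f θ z| ≤ C)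
    (hF : Differentiable ℝ (objective P f)) (hG : Continuous (gradient (objective P f)))
    (hGm : Measurable (smoothedGrad (objective P f) μ)) {B : ℝ}
    (hGB : ∀ x, ‖smoothedGrad (objective P f) μ x‖ ≤ B) (t : ℕ)
    (hv : ∀ᵐ ω ∂Q, ∀ i,
      0 ≤ (run f μ β₁ β₂ ζ η θ₀ v₀ (fun s => ξ s ω) (fun s k => u s k ω) t).v i) :
    let S := fun ω => run f μ β₁ β₂ ζ η θ₀ v₀ (fun s => ξ s ω) (fun s k => u s k ω) t
    let G := smoothedGrad (objective P f) μ
    Integrable (fun ω => inner ℝ (precond β₂ ζ (S ω) (G (S ω).θ))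
        (zoGrad f μ (S ω).θ (ξ t ω) fun k => u t k ω)) Q ∧
      Integrable (fun ω => inner ℝ (precond β₂ ζ (S ω) (G (S ω).θ)) (G (S ω).θ)) Q ∧
      ∫ ω, inner ℝ (precond β₂ ζ (S ω) (G (S ω).θ))
          (zoGrad f μ (S ω).θ (ξ t ω) fun k => u t k ω) ∂Q
        = ∫ ω, inner ℝ (precond β₂ ζ (S ω) (G (S ω).θ)) (G (S ω).θ) ∂Q := by
  intro S G
  have := isProbabilityMeasure_unifSphere hd
  have hB : 0 ≤ B := (norm_nonneg _).trans (hGB 0)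
  have hS := measurable_run (μ := μ) (β₁ := β₁) (β₂ := β₂) (ζ := ζ) (η := η) (θ₀ := θ₀) (v₀ := v₀)
    hf t (fun s _ => hs.measurable_ξ s) (fun s _ k => hs.measurable_u s k)
  have hθ : Measurable fun ω => (S ω).θ := hS.1
  have hp : Measurable fun ω => precond β₂ ζ (S ω) (G (S ω).θ) :=
    measurable_precond hS.2.2 (hGm.comp hθ)
  have hX : Measurable fun ω => (ξ t ω, fun k => u t k ω) :=
    (hs.measurable_ξ t).prodMk (measurable_pi_lambda _ fun k => hs.measurable_u t k)
  have hg : Measurable fun ω => zoGrad f μ (S ω).θ (ξ t ω) fun k => u t k ω :=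
    measurable_zoGrad hf hθ (hs.measurable_ξ t) fun k => hs.measurable_u t k
  have hpB : ∀ᵐ ω ∂Q, ‖precond β₂ ζ (S ω) (G (S ω).θ)‖ ≤ B / √ζ := by
    filter_upwards [hv] with ω hω
    refine (norm_precond_le hζ hβ₂ hω _).trans ?_
    gcongr
    exact hGB _
  have i1 : Integrable (fun ω => inner ℝ (precond β₂ ζ (S ω) (G (S ω).θ))
        (zoGrad f μ (S ω).θ (ξ t ω) fun k => u t k ω)) Q := by
    refine Integrable.of_bound (hp.inner hg).aestronglyMeasurable
      (B / √ζ * (2 * C * d / μ)) ?_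
    filter_upwards [hpB, hs.ae_norm_le_one hd] with ω h1 h2
    exact (norm_inner_le_norm _ _).trans (mul_le_mul h1
      (norm_zoGrad_le hK hμ hfC _ _ (h2 t)) (norm_nonneg _) (by positivity))
  have i2 : Integrable (fun ω => inner ℝ (precond β₂ ζ (S ω) (G (S ω).θ)) (G (S ω).θ)) Q := by
    refine Integrable.of_bound (hp.inner (hGm.comp hθ)).aestronglyMeasurable (B / √ζ * B) ?_
    filter_upwards [hpB] with ω h1
    exact (norm_inner_le_norm _ _).trans (mul_le_mul h1 (hGB _) (norm_nonneg _) (by positivity))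
  refine ⟨i1, i2, ?_⟩
  set W : Ω → Vec d × Vec d := fun ω => ((S ω).θ, precond β₂ ζ (S ω) (G (S ω).θ)) with hW
  have hWm : Measurable W := hθ.prodMk hp
  have hind : IndepFun W (fun ω => (ξ t ω, fun k => u t k ω)) Q := hs.indepFun_run hf t hGm
  have hmap := (indepFun_iff_map_prod_eq_prod_map_map hWm.aemeasurable hX.aemeasurable).1 hind
  rw [hs.law t] at hmap
  set Φ : (Vec d × Vec d) × (Ξ × (Fin K → Vec d)) → ℝ :=
    fun p => inner ℝ p.1.2 (zoGrad f μ p.1.1 p.2.1 p.2.2) with hΦ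
  have hΦm : Measurable Φ := (measurable_snd.comp measurable_fst).inner
    (measurable_zoGrad hf (measurable_fst.comp measurable_fst) (measurable_fst.comp measurable_snd)
      fun k => (measurable_pi_apply k).comp (measurable_snd.comp measurable_snd))
  have hWX := hWm.prodMk hX
  have hΦi : Integrable Φ ((Q.map W).prod
      (P.prod (Measure.pi fun _ : Fin K => unifSphere d))) := by
    rw [← hmap, integrable_map_measure hΦm.aestronglyMeasurable hWX.aemeasurable]
    exact i1
  have hΨm : Measurable fun w : Vec d × Vec d => (inner ℝ w.2 (G w.1) : ℝ) :=
    measurable_snd.inner (hGm.comp measurable_fst)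
  calc _ = ∫ p, Φ p ∂(Q.map W).prod (P.prod (Measure.pi fun _ : Fin K => unifSphere d)) := by
        rw [← hmap, integral_map hWX.aemeasurable hΦm.aestronglyMeasurable]
    _ = ∫ w, inner ℝ w.2 (G w.1) ∂Q.map W := by
        rw [integral_prod _ hΦi]
        congr 1
        ext1 w
        simp only [hΦ]
        rw [integral_inner (integrable_zoGrad hd hK hμ hf hfC w.1),
          integral_zoGrad hd hK hμ hf hfC hF hG]
    _ = _ := integral_map hWm.aemeasurable hΨm.aestronglyMeasurable

end Unbiased

/-! ### The averaged preconditioned gradient norm -/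

section Average

variable {d K : ℕ} {Ξ : Type*} {f : Vec d → Ξ → ℝ} {μ β₁ β₂ ζ η B C Λ : ℝ} {θ₀ v₀ : Vec d}

/-- The telescoped energy inequality, for a fixed realization of the samples. -/
theorem sum_inner_precond_le (hβ₁ : 0 ≤ β₁) (hβ₁' : β₁ ≤ 1) (hβ₂ : 1 / 2 ≤ β₂) (hβ₂' : β₂ < 1)
    (hζ : 0 < ζ) (hη : 0 < η) (hB : 0 ≤ B) (hΛ : 0 ≤ Λ) (hv₀ : ∀ i, 0 ≤ v₀ i)
    {H : Vec d → ℝ} {G : Vec d → Vec d} (hHC : ∀ x, |H x| ≤ C) (hG : ∀ x, ‖G x‖ ≤ B)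
    (hGΛ : ∀ x y, ‖G x - G y‖ ≤ Λ * ‖x - y‖)
    (hH : ∀ x y, H y ≤ H x + inner ℝ (G x) (y - x) + Λ * ‖y - x‖ ^ 2)
    (z : ℕ → Ξ) (u : ℕ → Fin K → Vec d)
    (hg : ∀ t, ‖zoGrad f μ (run f μ β₁ β₂ ζ η θ₀ v₀ z u t).θ (z t) (u t)‖ ≤ B)
    {Z : ℝ} (hZ : Z = 2 * Λ * η + (1 - β₂) * (B ^ 2 / √ζ)) (T : ℕ) :
    (1 - β₁) * ∑ t ∈ Finset.range T,
        inner ℝ (precond β₂ ζ (run f μ β₁ β₂ ζ η θ₀ v₀ z u t)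
            (G (run f μ β₁ β₂ ζ η θ₀ v₀ z u t).θ))
          (zoGrad f μ (run f μ β₁ β₂ ζ η θ₀ v₀ z u t).θ (z t) (u t))
      ≤ (1 - β₁) * (2 * C / η) + β₁ * (B ^ 2 / √ζ) + Z / (1 - β₂) * (d * (B ^ 2 / ζ))
        + T * (2 * d * Z + β₁ * ((1 - β₂) * (B ^ 2 / √ζ))) := by
  have hδ : 0 < 1 - β₂ := by linarith
  have hβ₂0 : 0 ≤ β₂ := by linarith
  have hz : 0 < √ζ := Real.sqrt_pos.2 hζ
  have hZ0 : 0 ≤ Z := by rw [hZ]; positivity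
  set S := run f μ β₁ β₂ ζ η θ₀ v₀ z u with hS
  have hb := run_bounds (f := f) (μ := μ) (ζ := ζ) (η := η) (θ₀ := θ₀) hβ₁ hβ₁' hβ₂0 hβ₂'.le hB
    hv₀ z u hg
  rw [← hS] at hb
  set e : ℕ → ℝ := fun t => energy β₁ β₂ ζ η (Z / (1 - β₂)) H G (S t) with he
  have hsum : (1 - β₁) * ∑ t ∈ Finset.range T, inner ℝ (precond β₂ ζ (S t) (G (S t).θ))
      (zoGrad f μ (S t).θ (z t) (u t))
      ≤ ∑ t ∈ Finset.range T, (e (t + 1) - e t + (2 * d * Z + β₁ * ((1 - β₂) * (B ^ 2 / √ζ)))) := by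
    rw [Finset.mul_sum]
    refine Finset.sum_le_sum fun t _ => ?_
    exact inner_precond_le_energy_sub hβ₁ hβ₁' hβ₂ hβ₂' hζ hη hB hΛ hG hGΛ hH
      (fun i => ((hb t).2 i).1) (hb (t + 1)).1 hZ
  rw [Finset.sum_add_distrib, Finset.sum_range_sub, Finset.sum_const, Finset.card_range,
    nsmul_eq_mul] at hsum
  have h1 : -(1 - β₁) * H (S T).θ / η - -(1 - β₁) * H (S 0).θ / η ≤ (1 - β₁) * (2 * C / η) := by
    have : -(1 - β₁) * H (S T).θ / η - -(1 - β₁) * H (S 0).θ / η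
        = (1 - β₁) * ((H (S 0).θ - H (S T).θ) / η) := by ring
    rw [this]
    refine mul_le_mul_of_nonneg_left ?_ (sub_nonneg.2 hβ₁')
    gcongr
    linarith [(abs_le.1 (hHC (S 0).θ)).2, (abs_le.1 (hHC (S T).θ)).1]
  have h2 : inner ℝ (G (S T).θ) (precond β₂ ζ (S T) (S T).m) ≤ B ^ 2 / √ζ := by
    refine (real_inner_le_norm _ _).trans ?_
    have := (norm_precond_le hζ hβ₂0 (fun i => ((hb T).2 i).1) (S T).m).trans
      (div_le_div_of_nonneg_right (hb T).1 hz.le)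
    calc _ ≤ B * (B / √ζ) := mul_le_mul (hG _) this (norm_nonneg _) hB
      _ = _ := by ring
  have h3 : inner ℝ (G (S 0).θ) (precond β₂ ζ (S 0) (S 0).m) = 0 := by
    have : precond β₂ ζ (S 0) (S 0).m = 0 := by
      ext i
      simp [precond, hS, run]
    rw [this, inner_zero_right]
  have h4 : ∑ i, Real.log ((S T).v i + ζ) - ∑ i, Real.log ((S 0).v i + ζ) ≤ d * (B ^ 2 / ζ) := by
    have : ∑ _i : Fin d, B ^ 2 / ζ = d * (B ^ 2 / ζ) := by simp
    rw [← this, ← Finset.sum_sub_distrib]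
    refine Finset.sum_le_sum fun i _ => ?_
    have hx : 0 < v₀ i + ζ := add_pos_of_nonneg_of_pos (hv₀ i) hζ
    have hy : 0 < (S T).v i + ζ := add_pos_of_nonneg_of_pos ((hb T).2 i).1 hζ
    have h0 : (S 0).v i = v₀ i := rfl
    rw [h0, ← Real.log_div hy.ne' hx.ne']
    refine (Real.log_le_sub_one_of_pos (div_pos hy hx)).trans ?_
    rw [div_sub_one hx.ne']
    have := ((hb T).2 i).2
    exact div_le_div₀ (sq_nonneg B) (by linarith) hζ (by linarith [hv₀ i])
  have h5 := mul_le_mul_of_nonneg_left h4 (div_nonneg hZ0 hδ.le)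
  have h6 := mul_le_mul_of_nonneg_left h2 hβ₁
  refine hsum.trans ?_
  simp only [he, energy, h3]
  linarith

theorem sq_norm_le_mul_inner_precond (hβ₂ : 0 ≤ β₂) (hβ₂' : β₂ ≤ 1) (hζ : 0 < ζ)
    {s : State d} {w : ℝ} (hv : ∀ i, 0 ≤ s.v i) (hw : ∀ i, s.v i + ζ ≤ w) (x : Vec d) :
    ‖x‖ ^ 2 ≤ √w * inner ℝ (precond β₂ ζ s x) x := by
  rw [EuclideanSpace.norm_sq_eq, PiLp.inner_apply, Finset.mul_sum]
  refine Finset.sum_le_sum fun i _ => ?_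
  have h0 : 0 ≤ β₂ * s.v i := mul_nonneg hβ₂ (hv i)
  have hD : 0 < √(β₂ * s.v i + ζ) := Real.sqrt_pos.2 (by positivity)
  have hDw : √(β₂ * s.v i + ζ) ≤ √w := Real.sqrt_le_sqrt (by
    linarith [mul_le_of_le_one_left (hv i) hβ₂', hw i])
  have h1 : 1 ≤ √w * (√(β₂ * s.v i + ζ))⁻¹ := by
    rw [← div_eq_mul_inv, one_le_div hD]
    exact hDw
  simp only [precond, RCLike.inner_apply, conj_trivial, Real.norm_eq_abs, sq_abs]
  calc x i ^ 2 = 1 * x i ^ 2 := (one_mul _).symm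
    _ ≤ √w * (√(β₂ * s.v i + ζ))⁻¹ * x i ^ 2 := by gcongr
    _ = _ := by ring

variable [MeasurableSpace Ξ] {P : Measure Ξ} [IsProbabilityMeasure P]
  {Ω : Type*} [MeasurableSpace Ω] {Q : Measure Ω} [IsProbabilityMeasure Q]
  {ξ : ℕ → Ω → Ξ} {u : ℕ → Fin K → Ω → Vec d}

theorem norm_smoothedGrad_le (hd : 0 < d) (hK : 0 < K) (hμ : 0 < μ)
    (hf : Measurable (Function.uncurry f)) (hfC : ∀ θ z, |f θ z| ≤ C)
    (hF : Differentiable ℝ (objective P f)) (hG : Continuous (gradient (objective P f)))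
    (θ : Vec d) : ‖smoothedGrad (objective P f) μ θ‖ ≤ 2 * C * d / μ := by
  have := isProbabilityMeasure_unifSphere hd
  rw [← integral_zoGrad hd hK hμ hf hfC hF hG]
  have h := norm_integral_le_of_norm_le_const
    (μ := P.prod (Measure.pi fun _ : Fin K => unifSphere d))
    (f := fun x => zoGrad f μ θ x.1 x.2) (C := 2 * C * d / μ) (by
      filter_upwards [ae_norm_le_one_pi_unifSphere (P := P) hd] with x hx
      exact norm_zoGrad_le hK hμ hfC θ x.1 hx)
  simpa using h

theorem abs_objective_le (hfC : ∀ θ z, |f θ z| ≤ C) (θ : Vec d) : |objective P f θ| ≤ C := by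
  have := norm_integral_le_of_norm_le_const (μ := P) (f := f θ) (.of_forall fun z => hfC θ z)
  simpa [objective] using this

theorem integral_le_of_ae_le {X : Ω → ℝ} {r : ℝ} (hX : Integrable X Q) (h : ∀ᵐ ω ∂Q, X ω ≤ r) :
    ∫ ω, X ω ∂Q ≤ r := by
  simpa using integral_mono_ae hX (integrable_const r) h

/-- If the bound of the energy inequality is at most `(1 - β₁) T ε²`, then the gradients of the
objective have mean norm at most `√W ε` up to the smoothing bias, where `W` bounds the
denominators. -/
theorem average_norm_gradient_le (hd : 0 < d) (hK : 0 < K) (hμ : 0 < μ)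
    (hβ₁ : 0 ≤ β₁) (hβ₁' : β₁ < 1) (hβ₂ : 1 / 2 ≤ β₂) (hβ₂' : β₂ < 1)
    (hζ : 0 < ζ) (hη : 0 < η) (hΛ : 0 ≤ Λ) (hv₀ : ∀ i, 0 ≤ v₀ i)
    (hf : Measurable (Function.uncurry f)) (hfC : ∀ θ z, |f θ z| ≤ C)
    (hF : Differentiable ℝ (objective P f))
    (hFΛ : ∀ x y, ‖gradient (objective P f) x - gradient (objective P f) y‖ ≤ Λ * ‖x - y‖)
    (hs : IsSampling P Q ξ u) {T : ℕ} (hT : 0 < T) {ε : ℝ} (hε : 0 < ε)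
    (hB : B = 2 * C * d / μ)
    {Z : ℝ} (hZ : Z = 2 * Λ * η + (1 - β₂) * (B ^ 2 / √ζ))
    (hbudget : (1 - β₁) * (2 * C / η) + β₁ * (B ^ 2 / √ζ) + Z / (1 - β₂) * (d * (B ^ 2 / ζ))
        + T * (2 * d * Z + β₁ * ((1 - β₂) * (B ^ 2 / √ζ))) ≤ (1 - β₁) * (T * ε ^ 2)) :
    (∀ t, Integrable (fun ω => ‖gradient (objective P f)
        (iterate f μ β₁ β₂ ζ η θ₀ v₀ ξ u t ω)‖) Q) ∧
    (1 / (T : ℝ)) * ∑ t ∈ Finset.range T, ∫ ω, ‖gradient (objective P f)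
        (iterate f μ β₁ β₂ ζ η θ₀ v₀ ξ u t ω)‖ ∂Q
      ≤ √(√(‖v₀‖ + B ^ 2 + ζ)) * ε + Λ * μ := by
  have hC : 0 ≤ C := (abs_nonneg _).trans (abs_objective_le (P := P) hfC 0)
  have hB0 : 0 ≤ B := by rw [hB]; positivity
  have hβ₂0 : 0 ≤ β₂ := by linarith
  have hGc := continuous_of_norm_sub_le_mul hFΛ
  set G := smoothedGrad (objective P f) μ with hG
  have hGB : ∀ x, ‖G x‖ ≤ B := fun x =>
    (norm_smoothedGrad_le hd hK hμ hf hfC hF hGc x).trans_eq hB.symm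
  have hGΛ : ∀ x y, ‖G x - G y‖ ≤ Λ * ‖x - y‖ := norm_smoothedGrad_sub_le hFΛ
  have hGm : Measurable G := (continuous_of_norm_sub_le_mul hGΛ).measurable
  have hbias : ∀ x, ‖gradient (objective P f) x‖ ≤ ‖G x‖ + Λ * μ := fun x => by
    have := norm_gradient_sub_smoothedGrad_le (μ := μ) hFΛ hΛ hμ.le x
    linarith [norm_le_norm_add_norm_sub' (gradient (objective P f) x) (G x)]
  set S : ℕ → Ω → State d := fun t ω =>
    run f μ β₁ β₂ ζ η θ₀ v₀ (fun s => ξ s ω) (fun s k => u s k ω) t with hS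
  have hit : ∀ t ω, iterate f μ β₁ β₂ ζ η θ₀ v₀ ξ u t ω = (S t ω).θ := fun t ω => rfl
  simp only [hit]
  have hθm : ∀ t, Measurable fun ω => (S t ω).θ := fun t =>
    (measurable_run hf t (fun s _ => hs.measurable_ξ s) (fun s _ k => hs.measurable_u s k)).1
  have hgB : ∀ᵐ ω ∂Q, ∀ t, ‖zoGrad f μ (S t ω).θ (ξ t ω) fun k => u t k ω‖ ≤ B := by
    filter_upwards [hs.ae_norm_le_one hd] with ω hω t
    exact (norm_zoGrad_le hK hμ hfC _ _ (hω t)).trans_eq hB.symm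
  have hbd : ∀ᵐ ω ∂Q, ∀ t i, 0 ≤ (S t ω).v i ∧ (S t ω).v i ≤ v₀ i + B ^ 2 := by
    filter_upwards [hgB] with ω hω t
    exact (run_bounds hβ₁ hβ₁'.le hβ₂0 hβ₂'.le hB0 hv₀ _ _ hω t).2
  have hunb := fun t => hs.integral_inner_zoGrad (β₁ := β₁) (η := η) (θ₀ := θ₀) (v₀ := v₀)
    hd hK hμ hζ hβ₂0 hf hfC hF hGc hGm hGB t (hbd.mono fun ω h i => (h t i).1)
  set N : ℕ → Ω → ℝ := fun t ω => inner ℝ (precond β₂ ζ (S t ω) (G (S t ω).θ)) (G (S t ω).θ)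
    with hN
  have hNi : ∀ t, Integrable (N t) Q := fun t => (hunb t).2.1
  have hsumN : ∑ t ∈ Finset.range T, ∫ ω, N t ω ∂Q ≤ T * ε ^ 2 := by
    refine le_of_mul_le_mul_left ?_ (sub_pos.2 hβ₁')
    refine le_trans ?_ hbudget
    rw [Finset.sum_congr rfl fun t _ => (hunb t).2.2.symm,
      ← integral_finsetSum _ fun t _ => (hunb t).1, ← integral_const_mul]
    refine integral_le_of_ae_le ((integrable_finsetSum _ fun t _ => (hunb t).1).const_mul _) ?_
    filter_upwards [hgB] with ω hω
    exact sum_inner_precond_le hβ₁ hβ₁'.le hβ₂ hβ₂' hζ hη hB0 hΛ hv₀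
      (abs_smoothed_le (abs_objective_le hfC)) hGB hGΛ
      (smoothed_le_add_inner_smoothedGrad hF hFΛ hΛ) _ _ hω hZ T
  set W := √(‖v₀‖ + B ^ 2 + ζ) with hW
  have hW0 : 0 < √W := Real.sqrt_pos.2 (Real.sqrt_pos.2 (by positivity))
  have hWW : √W ^ 2 = W := Real.sq_sqrt (Real.sqrt_nonneg _)
  have hpt : ∀ t, ∀ᵐ ω ∂Q, ‖G (S t ω).θ‖ ≤ √W / (2 * ε) * (ε ^ 2 + N t ω) := fun t => by
    filter_upwards [hbd] with ω hω
    have h := sq_norm_le_mul_inner_precond hβ₂0 hβ₂'.le hζ (fun i => (hω t i).1)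
      (w := ‖v₀‖ + B ^ 2 + ζ) (fun i => by
        linarith [(hω t i).2, (le_abs_self _).trans (abs_apply_le_norm v₀ i)]) (G (S t ω).θ)
    rw [← hW, ← hWW] at h
    rw [div_mul_eq_mul_div, le_div_iff₀ (by positivity)]
    -- The inequality `2 a b ≤ a² + b²` for `a = √W ε` and `b = ‖G‖`.
    refine le_of_mul_le_mul_left ?_ hW0
    have h2 := two_mul_le_add_sq (√W * ε) ‖G (S t ω).θ‖
    nlinarith
  have hGi : ∀ t, Integrable (fun ω => ‖G (S t ω).θ‖) Q := fun t =>
    Integrable.of_bound (hGm.comp (hθm t)).norm.aestronglyMeasurable B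
      (.of_forall fun ω => by simpa using hGB _)
  have hFi : ∀ t, Integrable (fun ω => ‖gradient (objective P f) (S t ω).θ‖) Q := fun t =>
    Integrable.of_bound (hGc.measurable.comp (hθm t)).norm.aestronglyMeasurable (B + Λ * μ)
      (.of_forall fun ω => by
        simpa using (hbias _).trans (add_le_add_left (hGB _) _))
  refine ⟨hFi, ?_⟩
  have hterm : ∀ t, ∫ ω, ‖gradient (objective P f) (S t ω).θ‖ ∂Q
      ≤ √W / (2 * ε) * (ε ^ 2 + ∫ ω, N t ω ∂Q) + Λ * μ := fun t => by
    have i1 : Integrable (fun ω => √W / (2 * ε) * (ε ^ 2 + N t ω)) Q :=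
      ((integrable_const _).add (hNi t)).const_mul _
    refine (integral_mono_ae (hFi t) (i1.add (integrable_const (Λ * μ))) ?_).trans_eq ?_
    · filter_upwards [hpt t] with ω hω
      exact (hbias _).trans (add_le_add_left hω _)
    · rw [integral_add' i1 (integrable_const _), integral_const_mul,
        integral_add (integrable_const _) (hNi t)]
      simp
  have hT' : (0 : ℝ) < T := by exact_mod_cast hT
  rw [one_div, inv_mul_le_iff₀ hT']
  calc _ ≤ ∑ t ∈ Finset.range T, (√W / (2 * ε) * (ε ^ 2 + ∫ ω, N t ω ∂Q) + Λ * μ) :=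
        Finset.sum_le_sum fun t _ => hterm t
    _ = √W / (2 * ε) * (T * ε ^ 2 + ∑ t ∈ Finset.range T, ∫ ω, N t ω ∂Q) + T * (Λ * μ) := by
        rw [Finset.sum_add_distrib, ← Finset.mul_sum, Finset.sum_add_distrib]
        simp
    _ ≤ √W / (2 * ε) * (T * ε ^ 2 + T * ε ^ 2) + T * (Λ * μ) := by gcongr
    _ = _ := by field_simp; ring

end Average

/-! ### The choice of the parameters -/

section Parameters

variable {d K : ℕ} {C L μ ζ β₁ β₂ η ε σ a₁ a₂ : ℝ} {v₀ : Vec d}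

theorem norm_gradient_sub_le_of_coordinates {F : Vec d → ℝ} (hL : 0 ≤ L)
    (hF : ∀ (x y : Vec d) (i : Fin d), |gradient F x i - gradient F y i| ≤ L * ‖x - y‖)
    (x y : Vec d) : ‖gradient F x - gradient F y‖ ≤ L * √d * ‖x - y‖ := by
  rw [EuclideanSpace.norm_eq]
  refine Real.sqrt_le_iff.2 ⟨by positivity, ?_⟩
  calc ∑ i, ‖(gradient F x - gradient F y) i‖ ^ 2 ≤ ∑ _i : Fin d, (L * ‖x - y‖) ^ 2 := by
        gcongr with i
        simpa using hF x y i
    _ = _ := by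
        rw [mul_pow (L * √d), mul_pow L √d, Real.sq_sqrt (Nat.cast_nonneg d)]
        simp
        ring

/-- The first term of `c₁⁻¹ / 3` is `2 d B² / ((1 - β₁)² √ζ)` with `B = 2 C d / μ`. -/
theorem c₁_eq {B : ℝ} (hB : B = 2 * C * d / μ) :
    c₁ d C μ ζ β₁ = (2 * d * (B ^ 2 / √ζ) / (1 - β₁) ^ 2
      + 2 * β₁ ^ 2 * d * √ζ / (1 - β₁) ^ 2)⁻¹ / 3 := by
  have : 8 * C ^ 2 * d ^ 3 / ((1 - β₁) ^ 2 * μ ^ 2 * √ζ)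
      = 2 * d * (B ^ 2 / √ζ) / (1 - β₁) ^ 2 := by
    rw [hB, mul_comm ((1 - β₁) ^ 2) (μ ^ 2)]
    simp only [div_eq_mul_inv, mul_inv, mul_pow]
    ring
  rw [c₁, this]

theorem mul_le_of_le_c₁_mul (hd : 0 < d) (hζ : 0 < ζ) (hβ₁ : 0 < β₁) (hβ₁' : β₁ < 1) {B : ℝ}
    (hB : B = 2 * C * d / μ) (h : 1 - β₂ ≤ c₁ d C μ ζ β₁ * ε ^ 2) :
    (1 - β₂) * (2 * d * (B ^ 2 / √ζ) + 2 * β₁ ^ 2 * d * √ζ) ≤ (1 - β₁) ^ 2 * ε ^ 2 / 3 := by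
  have hd' : (0 : ℝ) < d := by exact_mod_cast hd
  have hγ : 0 < 1 - β₁ := by linarith
  have hz : 0 < √ζ := Real.sqrt_pos.2 hζ
  rw [c₁_eq hB, ← add_div] at h
  set D := 2 * d * (B ^ 2 / √ζ) + 2 * β₁ ^ 2 * d * √ζ with hD
  have hD0 : 0 < D := by positivity
  calc (1 - β₂) * D ≤ (D / (1 - β₁) ^ 2)⁻¹ / 3 * ε ^ 2 * D := by gcongr
    _ = _ := by field_simp

/-- The parameters keep the bound of the energy inequality below `(1 - β₁) T ε²`: the smoothness
error, the error from decoupling numerator and denominator, and the terms that do not grow with `T`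
each get a third of it. -/
theorem energy_budget_le (hd : 0 < d) (hC : 0 ≤ C) (hL : 0 < L) (hζ : 0 < ζ)
    (hβ₁ : 0 < β₁) (hβ₁' : β₁ < 1) (ha₁ : 0 < a₁) (ha₂ : 0 < a₂) (hε : 0 < ε)
    (hβ₂ : 1 / 2 ≤ β₂) {B : ℝ} (hB : B = 2 * C * d / μ)
    (h1 : a₁ * ε ^ 2 ≤ 1 - β₂) (h2 : 1 - β₂ ≤ c₁ d C μ ζ β₁ * ε ^ 2)
    (h3 : a₂ * ε ^ 2 ≤ η) (h4 : η ≤ c₂ d L β₁ * ε ^ 2) {T : ℝ} {κ : ℝ}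
    (hκ : κ = β₁ * (B ^ 2 / √ζ)
      + (2 * (L * √d) * c₂ d L β₁ / a₁ + B ^ 2 / √ζ) * (d * (B ^ 2 / ζ)))
    (hT : 3 * (2 * C / a₂ + κ / (2 * a₁) / (1 - β₁)) / ε ^ 4 ≤ T)
    {Z : ℝ} (hZ : Z = 2 * (L * √d) * η + (1 - β₂) * (B ^ 2 / √ζ)) :
    (1 - β₁) * (2 * C / η) + β₁ * (B ^ 2 / √ζ) + Z / (1 - β₂) * (d * (B ^ 2 / ζ))
        + T * (2 * d * Z + β₁ * ((1 - β₂) * (B ^ 2 / √ζ))) ≤ (1 - β₁) * (T * ε ^ 2) := by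
  have hd' : (1 : ℝ) ≤ d := by exact_mod_cast hd
  have hγ : 0 < 1 - β₁ := by linarith
  have hz : 0 < √ζ := Real.sqrt_pos.2 hζ
  have hsd : 0 < √(d : ℝ) := Real.sqrt_pos.2 (by linarith)
  have hε2 : 0 < ε ^ 2 := by positivity
  have hδ : 0 < 1 - β₂ := lt_of_lt_of_le (by positivity) h1
  have hη : 0 < η := lt_of_lt_of_le (by positivity) h3
  have hc₂ : 0 < c₂ d L β₁ := by unfold c₂; positivity
  have hmain := mul_le_of_le_c₁_mul hd hζ hβ₁ hβ₁' hB h2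
  set A := B ^ 2 / √ζ with hA
  have hA0 : 0 ≤ A := by positivity
  have hκ0 : 0 ≤ κ := by rw [hκ]; positivity
  have hT0 : 0 ≤ T := le_trans (by positivity) hT
  -- The smoothness error.
  have e1 : 2 * d * (2 * (L * √d) * η) ≤ (1 - β₁) * ε ^ 2 / 3 := by
    have : 2 * d * (2 * (L * √d) * η) ≤ 2 * d * (2 * (L * √d) * (c₂ d L β₁ * ε ^ 2)) := by gcongr
    refine this.trans ?_
    have e : 2 * d * (2 * (L * √d) * (c₂ d L β₁ * ε ^ 2))
        = (1 - β₁) * (1 - β₁) * ε ^ 2 / 12 := by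
      unfold c₂
      field_simp
      norm_num
    rw [e]
    nlinarith [mul_pos hγ hε2, mul_pos hβ₁ (mul_pos hγ hε2)]
  -- The decoupling error.
  have e2 : 2 * d * ((1 - β₂) * A) + β₁ * ((1 - β₂) * A) ≤ (1 - β₁) * ε ^ 2 / 3 := by
    have hx : 0 ≤ (1 - β₂) * A := by positivity
    have hy : (1 - β₂) * (2 * d * A) ≤ (1 - β₁) ^ 2 * ε ^ 2 / 3 := by
      refine le_trans ?_ hmain
      have : 0 ≤ 2 * β₁ ^ 2 * d * √ζ := by positivity
      gcongr
      linarith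
    calc 2 * d * ((1 - β₂) * A) + β₁ * ((1 - β₂) * A)
        ≤ (1 + β₁) * ((1 - β₂) * (2 * d * A)) := by
          nlinarith [mul_nonneg hβ₁.le hx, mul_nonneg (sub_nonneg.2 hd') (mul_nonneg hβ₁.le hx)]
      _ ≤ (1 + β₁) * ((1 - β₁) ^ 2 * ε ^ 2 / 3) := by gcongr
      _ ≤ (1 - β₁) * ε ^ 2 / 3 := by
          have : 0 ≤ β₁ ^ 2 * ((1 - β₁) * ε ^ 2) := by positivity
          nlinarith
  -- The terms that do not grow with `T`, where `a₁ ε² ≤ 1 - β₂ ≤ 1 / 2` bounds `ε`.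
  have e3 : (1 - β₁) * (2 * C / η) + β₁ * A + Z / (1 - β₂) * (d * (B ^ 2 / ζ))
      ≤ (1 - β₁) * (T * ε ^ 2) / 3 := by
    have f1 : 2 * C / η ≤ 2 * C / (a₂ * ε ^ 2) := by gcongr
    have f2 : Z / (1 - β₂) ≤ 2 * (L * √d) * c₂ d L β₁ / a₁ + A := by
      rw [hZ, add_div, mul_div_cancel_left₀ _ hδ.ne']
      refine add_le_add_left ?_ _
      calc 2 * (L * √d) * η / (1 - β₂)
          ≤ 2 * (L * √d) * (c₂ d L β₁ * ε ^ 2) / (a₁ * ε ^ 2) := by gcongr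
        _ = _ := by field_simp
    have f3 : β₁ * A + Z / (1 - β₂) * (d * (B ^ 2 / ζ)) ≤ κ := by
      rw [hκ]
      gcongr
    have f4 : κ ≤ κ / (2 * a₁) / ε ^ 2 := by
      rw [div_div, le_div_iff₀ (by positivity)]
      refine mul_le_of_le_one_right hκ0 ?_
      linarith
    have f5 : (1 - β₁) * (2 * C / (a₂ * ε ^ 2)) + κ / (2 * a₁) / ε ^ 2
        = (1 - β₁) * (3 * (2 * C / a₂ + κ / (2 * a₁) / (1 - β₁)) / ε ^ 4 * ε ^ 2) / 3 := by
      field_simp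
    have f6 := mul_le_mul_of_nonneg_left f1 hγ.le
    have f7 : (1 - β₁) * (3 * (2 * C / a₂ + κ / (2 * a₁) / (1 - β₁)) / ε ^ 4 * ε ^ 2) / 3
        ≤ (1 - β₁) * (T * ε ^ 2) / 3 := by gcongr
    linarith
  have e4 : 2 * d * Z + β₁ * ((1 - β₂) * A) ≤ 2 * ((1 - β₁) * ε ^ 2 / 3) := by
    rw [hZ]
    linarith
  have e5 := mul_le_mul_of_nonneg_left e4 hT0
  linarith

theorem sqrt_add_le_sqrt_add_sqrt {x y : ℝ} (hx : 0 ≤ x) (hy : 0 ≤ y) : √(x + y) ≤ √x + √y := by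
  simpa only [Real.sqrt_eq_rpow] using
    Real.rpow_add_le_add_rpow hx hy (p := 1 / 2) (by norm_num) (by norm_num)

theorem sqrt_sqrt_add_le {x y z : ℝ} (hx : 0 ≤ x) (hy : 0 ≤ y) (hz : 0 ≤ z) :
    √(√(x + y ^ 2 + z)) ≤ √(√x) + √y + √(√z) := by
  have h1 : √(x + y ^ 2 + z) ≤ √x + y + √z := by
    refine (sqrt_add_le_sqrt_add_sqrt (by positivity) hz).trans ?_
    have := sqrt_add_le_sqrt_add_sqrt hx (sq_nonneg y)
    rw [Real.sqrt_sq hy] at this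
    linarith
  refine (Real.sqrt_le_sqrt h1).trans ?_
  have h2 := sqrt_add_le_sqrt_add_sqrt (by positivity : 0 ≤ √x + y) (Real.sqrt_nonneg z)
  have h3 := sqrt_add_le_sqrt_add_sqrt (Real.sqrt_nonneg x) hy
  linarith

/-- The contribution of the gradient estimates to the denominators is absorbed by the first term
of the bound, by the inequality between arithmetic and geometric mean in the definition of `c₁`. -/
theorem sqrt_mul_le_of_le_c₁_mul (hd : 0 < d) (hζ : 0 < ζ) (hβ₁ : 0 < β₁) (hβ₁' : β₁ < 1)
    (hε : 0 < ε) (hβ₂ : β₂ < 1) {B : ℝ} (hB0 : 0 ≤ B) (hB : B = 2 * C * d / μ)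
    (h : 1 - β₂ ≤ c₁ d C μ ζ β₁ * ε ^ 2) :
    √B * ε ≤ (1 + β₁) * √d / √(β₁ * (1 - β₂)) * ε ^ 2 := by
  have hd' : (1 : ℝ) ≤ d := by exact_mod_cast hd
  have hδ : 0 < 1 - β₂ := by linarith
  have hz : 0 < √ζ := Real.sqrt_pos.2 hζ
  have hmain := mul_le_of_le_c₁_mul hd hζ hβ₁ hβ₁' hB h
  have h1 : 2 * (B * β₁) ≤ B ^ 2 / √ζ + β₁ ^ 2 * √ζ := by
    have := sq_nonneg (B - β₁ * √ζ)
    have e : B ^ 2 / √ζ + β₁ ^ 2 * √ζ = (B ^ 2 + β₁ ^ 2 * √ζ ^ 2) / √ζ := by field_simp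
    rw [e, le_div_iff₀ hz]
    nlinarith
  have h2 : (1 - β₂) * (B * β₁) ≤ ε ^ 2 := by
    have e1 : (1 - β₂) * (2 * (B * β₁)) ≤ (1 - β₂) * (B ^ 2 / √ζ + β₁ ^ 2 * √ζ) := by gcongr
    have e2 : 0 ≤ (1 - β₂) * (B ^ 2 / √ζ + β₁ ^ 2 * √ζ) := by positivity
    have e3 := mul_nonneg (sub_nonneg.2 hd') e2
    have e4 : (1 - β₁) ^ 2 * ε ^ 2 ≤ ε ^ 2 := by
      refine mul_le_of_le_one_left (sq_nonneg ε) ?_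
      nlinarith
    nlinarith
  have h3 : √B * √(β₁ * (1 - β₂)) ≤ ε := by
    rw [← Real.sqrt_mul hB0]
    refine Real.sqrt_le_iff.2 ⟨hε.le, ?_⟩
    linarith
  have h4 : 1 ≤ (1 + β₁) * √d := one_le_mul_of_one_le_of_one_le (by linarith)
    (Real.one_le_sqrt.2 hd')
  have hs : 0 < √(β₁ * (1 - β₂)) := Real.sqrt_pos.2 (by positivity)
  rw [div_mul_eq_mul_div, le_div_iff₀ hs]
  have h5 := mul_le_mul_of_nonneg_right h3 hε.le
  have h6 := mul_le_mul_of_nonneg_right h4 (sq_nonneg ε)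
  linarith

theorem sqrt_sqrt_norm_le_sqrt_V_mul (hd : 0 < d) (hβ₁ : 0 < β₁) (hβ₁' : β₁ < 1) (hβ₂ : β₂ < 1) :
    √(√‖v₀‖) ≤ √(V K C L σ μ β₁ β₂ η v₀ * d) := by
  have hd' : (1 : ℝ) ≤ d := by exact_mod_cast hd
  have h1 : 0 ≤ 1 - β₁ := by linarith
  have h2 : 0 ≤ 1 - β₂ := by linarith
  have h3 : √‖v₀‖ ≤ V K C L σ μ β₁ β₂ η v₀ := by
    refine Real.sqrt_le_sqrt ?_
    have e1 : 0 ≤ sigmaSq d K C σ μ := by unfold sigmaSq; positivity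
    have e2 : 0 ≤ β₁ * (1 + β₁) ^ 2 * L ^ 2 * η ^ 2 * d / ((1 - β₁) ^ 2 * (1 - β₂)) := by
      positivity
    have e3 := mul_nonneg h1 e1
    linarith
  exact Real.sqrt_le_sqrt (h3.trans (le_mul_of_one_le_right (Real.sqrt_nonneg _) hd'))

end Parameters

end RAdaZO

theorem mainTheorem4
    (d : ℕ) (hd : 0 < d)
    (C L μ ζ β₁ : ℝ) (hL : 0 < L) (hμ : 0 < μ) (hζ : 0 < ζ) (hβ₁ : 0 < β₁) (hβ₁' : β₁ < 1)
    (v₀ : RAdaZO.Vec d) (hv₀ : ∀ i, 0 < v₀ i)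
    (a₁ a₂ : ℝ) (ha₁ : 0 < a₁) (ha₂ : 0 < a₂) :
    ∃ c₃ : ℝ, 0 < c₃ ∧
      ∀ {Ξ Ω : Type*} [MeasurableSpace Ξ] [MeasurableSpace Ω]
        (P : Measure Ξ) [IsProbabilityMeasure P] (Q : Measure Ω) [IsProbabilityMeasure Q]
        (K : ℕ) (_ : 0 < K) (σ : ℝ)
        (f : RAdaZO.Vec d → Ξ → ℝ) (_ : Measurable (Function.uncurry f))
        (_ : RAdaZO.BoundedSmooth P f C L) (_ : RAdaZO.BoundedVariance P f σ)
        (ξ : ℕ → Ω → Ξ) (u : ℕ → Fin K → Ω → RAdaZO.Vec d) (_ : RAdaZO.IsSampling P Q ξ u)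
        (θ₀ : RAdaZO.Vec d) (ε β₂ η : ℝ) (T : ℕ),
        0 < ε →
        β₁ ≤ √β₂ → 1 / 2 ≤ β₂ →
        a₁ * ε ^ 2 ≤ 1 - β₂ → 1 - β₂ ≤ RAdaZO.c₁ d C μ ζ β₁ * ε ^ 2 →
        a₂ * ε ^ 2 ≤ η → η ≤ RAdaZO.c₂ d L β₁ * ε ^ 2 →
        c₃ / ε ^ 4 ≤ T →
        (∀ t, Integrable (fun ω => ‖gradient (RAdaZO.objective P f)
            (RAdaZO.iterate f μ β₁ β₂ ζ η θ₀ v₀ ξ u t ω)‖) Q) ∧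
        (1 / (T : ℝ)) * ∑ t ∈ Finset.range T, ∫ ω, ‖gradient (RAdaZO.objective P f)
            (RAdaZO.iterate f μ β₁ β₂ ζ η θ₀ v₀ ξ u t ω)‖ ∂Q
          ≤ (1 + β₁) * √d / √(β₁ * (1 - β₂)) * ε ^ 2
            + (ζ ^ (1 / 4 : ℝ) + √(RAdaZO.V K C L σ μ β₁ β₂ η v₀ * d)) * ε
            + μ * L * √d := by
  set B : ℝ := 2 * C * d / μ with hB
  set κ : ℝ := β₁ * (B ^ 2 / √ζ)
    + (2 * (L * √d) * RAdaZO.c₂ d L β₁ / a₁ + B ^ 2 / √ζ) * (d * (B ^ 2 / ζ)) with hκ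
  -- The maximum keeps `c₃` positive when `C ≤ 0`; `0 ≤ C` follows from the bound on `f` only.
  refine ⟨max 1 (3 * (2 * C / a₂ + κ / (2 * a₁) / (1 - β₁))), by positivity, ?_⟩
  intro Ξ Ω _ _ P _ Q _ K hK σ f hf hfs _ ξ u hs θ₀ ε β₂ η T hε _ hβ₂ h1 h2 h3 h4 hT
  have hC : 0 ≤ C := (abs_nonneg _).trans (RAdaZO.abs_objective_le (P := P) hfs.bounded 0)
  have hB0 : 0 ≤ B := by positivity
  have hβ₂' : β₂ < 1 := by nlinarith [mul_pos ha₁ (pow_pos hε 2)]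
  have hη : 0 < η := lt_of_lt_of_le (by positivity) h3
  have hT0 : 0 < T := by
    have : (0 : ℝ) < T := lt_of_lt_of_le (by positivity) hT
    exact_mod_cast this
  have hT' : 3 * (2 * C / a₂ + κ / (2 * a₁) / (1 - β₁)) / ε ^ 4 ≤ T :=
    (div_le_div_of_nonneg_right (le_max_right _ _) (by positivity)).trans hT
  have hbudget := RAdaZO.energy_budget_le hd hC hL hζ hβ₁ hβ₁' ha₁ ha₂ hε hβ₂ hB h1 h2 h3 h4 hκ
    hT' rfl
  obtain ⟨hint, havg⟩ := RAdaZO.average_norm_gradient_le (θ₀ := θ₀) (v₀ := v₀) hd hK hμ hβ₁.le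
    hβ₁' hβ₂ hβ₂' hζ hη (by positivity) (fun i => (hv₀ i).le) hf hfs.bounded hfs.differentiable
    (RAdaZO.norm_gradient_sub_le_of_coordinates hL.le hfs.smooth) hs hT0 hε hB rfl hbudget
  refine ⟨hint, havg.trans ?_⟩
  have e1 : ζ ^ (1 / 4 : ℝ) = √(√ζ) := by
    rw [Real.sqrt_eq_rpow, Real.sqrt_eq_rpow, ← Real.rpow_mul hζ.le]
    norm_num
  have e2 := mul_le_mul_of_nonneg_right
    (RAdaZO.sqrt_sqrt_add_le (norm_nonneg v₀) hB0 hζ.le) hε.le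
  have e3 := RAdaZO.sqrt_mul_le_of_le_c₁_mul hd hζ hβ₁ hβ₁' hε hβ₂' hB0 hB h2
  have e4 := mul_le_mul_of_nonneg_right (RAdaZO.sqrt_sqrt_norm_le_sqrt_V_mul (K := K) (C := C)
    (L := L) (σ := σ) (μ := μ) (η := η) (v₀ := v₀) hd hβ₁ hβ₁' hβ₂') hε.le
  rw [e1]
  linarith
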